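/- Let $\mathbb{N}=\{1,2,\dots\}$ and let $\mathcal{P}$ be the space of partitions $\pi=(\pi_1,\pi_2,\dots)$ of $\mathbb{N}$, with blocks listed in the increasing order of their least elements (and $\pi_i=\emptyset$ if $\pi$ has fewer than $i$ blocks), equipped with the distance $d(\pi,\pi')=1/\max\{n:\pi_{|[n]}=\pi'_{|[n]}\}$ ($d(\pi,\pi)=0$), where $\pi_{|[n]}$ is the restriction of $\pi$ to $[n]=\{1,\dots,n\}$; this is a compact metric space. For $n\ge 1$ let $D_n$ be the space of functions $f:\mathcal{P}\to\mathbb{R}$ such that $f(\pi)=f(\eta)$ whenever $\pi_{|[n]}=\eta_{|[n]}$ (they are continuous), and let $D_\infty=\bigcup_{n\ge1}D_n$. For $\eta,\pi\in\mathcal{P}$ and $i\ge1$ let $\eta\circ_i\pi$ be the partition obtained from $\eta$ by replacing its $i$-th block $B=\eta_i$ with the nonempty ones among the blocks $\{B(j): j\in\pi_l\}$ (over those $j$ for which $B(j)$ exists), $l\ge1$, where $B(j)$ is the $j$-th smallest element of $B$ (and $\eta\circ_i\pi=\eta$ if $\eta_i=\emptyset$). For $k\ge2$ let $\mathbf{p}_k$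 be the law of the random partition of $\mathbb{N}$ into black and red balls generated by the following Pólya urn: balls $1,\dots,k-1$ are black, ball $k$ is red, and for $n\ge k$ the ball $n+1$ receives the colour of a ball picked uniformly at random among the balls $1,\dots,n$, the picks being independent. Put $\mathbf{r}=\sum_{k\ge2}\mathbf{p}_k$. Let $\mathbb{T}$ be the infinite random recursive tree on $\mathbb{N}$: the parent of each vertex $i\ge2$ is uniformly distributed on $\{1,\dots,i-1\}$, independently over $i$. For $i\ge2$ the edge between $i$ and its parent is removed at time $\epsilon_i$, where the $\epsilon_i$ are i.i.d. standard exponential variables independent of $\mathbb{T}$. Let $\Pi(t)$ be the partition of $\mathbb{N}$ into the connected components of the forest formed by the edges that have not been removed by time $t$, and let $\Pi=(\Pi(t):t\ge0)$. Theorem. (i) $\Pi$ is a Markov process with the Feller property: there is a unique Feller semigroup $(T_t)_{t\ge0}$ on $\mathcal{C}(\mathcal{P})$ (a strongly continuous semigroup of positive linear operators with $T_t1=1$) such that $\mathbb{E}[f(\Pi(s+t))\mid \Pi(r), r\le s]=T_tf(\Pi(s))$ almost surely for all $s,t\ge0$ and $f\in\mathcal{C}(\mathcal{P})$. Let $\mathrm{G}$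 be its infinitesimal generator. (ii) For every $n\ge1$, $D_n$ is invariant, i.e. $T_t D_n\subseteq D_n$ for all $t\ge0$, and $D_\infty$ is a core for $\mathrm{G}$, i.e. $D_\infty$ is contained in the domain of $\mathrm{G}$ and $\mathrm{G}$ is the closure of its restriction to $D_\infty$. (iii) For every $f\in D_\infty$ and $\eta\in\mathcal{P}$, $$\mathrm{G}f(\eta)=\int_{\mathcal{P}}\mathbf{r}(d\pi)\sum_{i\ge1}\bigl(f(\eta\circ_i\pi)-f(\eta)\bigr),$$ where the sum converges absolutely for every $\pi$ and defines an $\mathbf{r}$-integrable function of $\pi$. -/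

import Mathlib

open MeasureTheory ProbabilityTheory Filter Topology
open scoped NNReal ENNReal

/-! ### Partitions of the set of natural numbers

All labels are shifted by one: the natural number `i` here stands for the vertex (ball, integer,
block index) that is labelled `i + 1` when the natural numbers are counted from `1`. In particular
the first `n` integers are `0, …, n - 1`. -/

/-- A partition of `ℕ`, given by the equivalence relation "being in the same block". -/
@[ext]
structure NatPartition where
  /-- `i` and `j` belong to the same block. -/
  rel : ℕ → ℕ → Prop
  iseqv : Equivalence rel

namespace NatPartition

/-- The restrictions of `η` and `π` to the first `n` integers coincide. -/
def AgreeOn (n : ℕ) (η π : NatPartition) : Prop :=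
  ∀ i < n, ∀ j < n, (η.rel i j ↔ π.rel i j)

theorem AgreeOn.refl (n : ℕ) (η : NatPartition) : AgreeOn n η η := fun _ _ _ _ => Iff.rfl

theorem AgreeOn.symm {n : ℕ} {η π : NatPartition} (h : AgreeOn n η π) : AgreeOn n π η :=
  fun i hi j hj => (h i hi j hj).symm

theorem AgreeOn.trans {n : ℕ} {η π ρ : NatPartition} (h : AgreeOn n η π) (h' : AgreeOn n π ρ) :
    AgreeOn n η ρ := fun i hi j hj => (h i hi j hj).trans (h' i hi j hj)

theorem AgreeOn.mono {m n : ℕ} (hmn : m ≤ n) {η π : NatPartition} (h : AgreeOn n η π) :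
    AgreeOn m η π := fun i hi j hj => h i (hi.trans_le hmn) j (hj.trans_le hmn)

theorem agreeOn_one (η π : NatPartition) : AgreeOn 1 η π := by
  intro i hi j hj
  obtain rfl : i = 0 := by omega
  obtain rfl : j = 0 := by omega
  exact ⟨fun _ => π.iseqv.refl 0, fun _ => η.iseqv.refl 0⟩

/-- The distance `1 / max {n ≥ 1 | the restrictions to the first n integers coincide}`, which is
`0` if the two partitions are equal. -/
noncomputable instance instDist : Dist NatPartition where
  dist η π := sInf {x : ℝ | ∃ n : ℕ, 1 ≤ n ∧ AgreeOn n η π ∧ x = 1 / n}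

theorem dist_set_bddBelow (η π : NatPartition) :
    BddBelow {x : ℝ | ∃ n : ℕ, 1 ≤ n ∧ AgreeOn n η π ∧ x = 1 / n} :=
  ⟨0, by rintro x ⟨n, -, -, rfl⟩; positivity⟩

theorem dist_nonneg' (η π : NatPartition) : 0 ≤ dist η π :=
  Real.sInf_nonneg (by rintro x ⟨n, -, -, rfl⟩; positivity)

theorem dist_le_of_agreeOn {n : ℕ} (hn : 1 ≤ n) {η π : NatPartition} (h : AgreeOn n η π) :
    dist η π ≤ 1 / n :=
  csInf_le (dist_set_bddBelow η π) ⟨n, hn, h, rfl⟩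

theorem exists_of_dist_lt {η π : NatPartition} {c : ℝ} (h : dist η π < c) :
    ∃ n : ℕ, 1 ≤ n ∧ AgreeOn n η π ∧ (1 / n : ℝ) < c := by
  obtain ⟨x, ⟨n, hn, ha, rfl⟩, hx⟩ :=
    exists_lt_of_csInf_lt (s := {x : ℝ | ∃ n : ℕ, 1 ≤ n ∧ AgreeOn n η π ∧ x = 1 / n})
      ⟨1, 1, le_rfl, agreeOn_one η π, by norm_num⟩ h
  exact ⟨n, hn, ha, hx⟩

theorem dist_comm' (η π : NatPartition) : dist η π = dist π η := by
  have h : ∀ n, AgreeOn n η π ↔ AgreeOn n π η := fun n => ⟨AgreeOn.symm, AgreeOn.symm⟩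
  change sInf _ = sInf _
  simp only [h]

theorem dist_ultra (η π ρ : NatPartition) : dist η ρ ≤ max (dist η π) (dist π ρ) := by
  refine le_of_forall_gt fun c hc => ?_
  obtain ⟨h1, h2⟩ := max_lt_iff.1 hc
  obtain ⟨m, hm, ham, hmc⟩ := exists_of_dist_lt h1
  obtain ⟨n, hn, han, hnc⟩ := exists_of_dist_lt h2
  rcases le_total m n with h | h
  · exact (dist_le_of_agreeOn hm (ham.trans (han.mono h))).trans_lt hmc
  · exact (dist_le_of_agreeOn hn ((ham.mono h).trans han)).trans_lt hnc

noncomputable instance instMetricSpace : MetricSpace NatPartition where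
  dist_self η := by
    refine le_antisymm (le_of_forall_pos_le_add fun e he => ?_) (dist_nonneg' η η)
    obtain ⟨n, hn⟩ := exists_nat_one_div_lt he
    have := dist_le_of_agreeOn (n := n + 1) (by omega) (AgreeOn.refl _ η)
    push_cast at this
    linarith
  dist_comm := dist_comm'
  dist_triangle η π ρ := (dist_ultra η π ρ).trans
    (max_le_add_of_nonneg (dist_nonneg' _ _) (dist_nonneg' _ _))
  eq_of_dist_eq_zero := by
    intro η π h
    ext i j
    have hpos : (0 : ℝ) < 1 / ((i + j + 1 : ℕ) : ℝ) := by positivity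
    obtain ⟨n, hn, ha, hlt⟩ := exists_of_dist_lt (h.trans_lt hpos)
    have hn' : i + j + 1 < n := by
      have := (one_div_lt_one_div (by exact_mod_cast hn) (by positivity)).1 hlt
      exact_mod_cast this
    exact ha i (by omega) j (by omega)

/-- The space of partitions is compact. -/
instance instCompactSpace : CompactSpace NatPartition := by
  let K : Set (ℕ → ℕ → Bool) := {a | (∀ i, a i i = true) ∧ (∀ i j, a i j = true → a j i = true) ∧
    ∀ i j k, a i j = true → a j k = true → a i k = true}
  have hev : ∀ i j, Continuous fun a : ℕ → ℕ → Bool => a i j := fun i j => by fun_prop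
  have hcl : ∀ i j (b : Bool), IsClopen {a : ℕ → ℕ → Bool | a i j = b} := fun i j b =>
    (isClopen_discrete {b}).preimage (hev i j)
  have hK : IsClosed K := by
    have hi : ∀ p q : Set (ℕ → ℕ → Bool), IsClopen p → IsClosed q →
        IsClosed {a | a ∈ p → a ∈ q} := fun p q hp hq => by
      have : {a | a ∈ p → a ∈ q} = pᶜ ∪ q := by ext a; simp [imp_iff_not_or]
      rw [this]
      exact hp.compl.isClosed.union hq
    simp only [K, Set.ofPred_and]
    refine IsClosed.inter ?_ (IsClosed.inter ?_ ?_)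
    · simp only [Set.ofPred_forall]
      exact isClosed_iInter fun i => (hcl i i true).isClosed
    · simp only [Set.ofPred_forall]
      exact isClosed_iInter fun i => isClosed_iInter fun j =>
        hi _ _ (hcl i j true) (hcl j i true).isClosed
    · simp only [Set.ofPred_forall]
      exact isClosed_iInter fun i => isClosed_iInter fun j => isClosed_iInter fun k =>
        hi _ _ (hcl i j true) (hi _ _ (hcl j k true) (hcl i k true).isClosed)
  have : CompactSpace K := isCompact_iff_compactSpace.1 hK.isCompact
  let F : K → NatPartition := fun a =>
    ⟨fun i j => a.1 i j = true, fun i => a.2.1 i, fun {i j} h => a.2.2.1 i j h,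
      fun {i j k} h h' => a.2.2.2 i j k h h'⟩
  have hF : Continuous F := by
    rw [continuous_iff_continuousAt]
    intro a
    rw [ContinuousAt, Metric.tendsto_nhds]
    intro e he
    obtain ⟨n, hn⟩ := exists_nat_one_div_lt he
    have h : ∀ᶠ b : K in 𝓝 a, ∀ i ∈ Set.Iio (n + 1), ∀ j ∈ Set.Iio (n + 1), b.1 i j = a.1 i j := by
      rw [eventually_all_finite (Set.finite_Iio _)]
      intro i _
      rw [eventually_all_finite (Set.finite_Iio _)]
      intro j _
      have hc : Continuous fun b : K => b.1 i j := (hev i j).comp continuous_subtype_val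
      have hs : IsOpen {b : K | b.1 i j = a.1 i j} := (isOpen_discrete {a.1 i j}).preimage hc
      exact hs.mem_nhds rfl
    filter_upwards [h] with b hb
    have hag : AgreeOn (n + 1) (F b) (F a) := fun i hi j hj => by
      change b.1 i j = true ↔ a.1 i j = true
      rw [hb i hi j hj]
    have := dist_le_of_agreeOn (by omega) hag
    push_cast at this
    exact this.trans_lt hn
  have hs : Function.Surjective F := by
    classical
    intro η
    refine ⟨⟨fun i j => decide (η.rel i j), ?_, ?_, ?_⟩, ?_⟩
    · intro i; simpa using η.iseqv.refl i
    · intro i j h; simpa using η.iseqv.symm (by simpa using h)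
    · intro i j k h h'; simpa using η.iseqv.trans (by simpa using h) (by simpa using h')
    · ext i j; simp [F]
  exact ⟨by rw [← hs.range_eq]; exact isCompact_range hF⟩

noncomputable instance instMeasurableSpace : MeasurableSpace NatPartition := borel NatPartition

instance instBorelSpace : BorelSpace NatPartition := ⟨rfl⟩

/-- `m` is the smallest element of its block. -/
def IsMin (η : NatPartition) (m : ℕ) : Prop := ∀ j < m, ¬ η.rel j m

/-- The smallest element of the block that contains `x`. -/
noncomputable def blockMin (η : NatPartition) (x : ℕ) : ℕ := sInf {y | η.rel y x}

/-- The index (counted from `0`) of the block that contains `x`, when the blocks are listed in the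
increasing order of their smallest elements: the number of blocks with a smaller least element. -/
noncomputable def blockIndex (η : NatPartition) (x : ℕ) : ℕ :=
  {m : ℕ | η.IsMin m ∧ m < η.blockMin x}.ncard

/-- The `i`-th block of `η`. It is empty if `η` has at most `i` blocks. -/
def block (η : NatPartition) (i : ℕ) : Set ℕ := {x | η.blockIndex x = i}

/-- The position (counted from `0`) of `x` in the increasing enumeration of the set `B`. If `B(j)`
denotes the `j`-th smallest element of `B`, then `x = B(posIn B x)` for every `x ∈ B`. -/
noncomputable def posIn (B : Set ℕ) (x : ℕ) : ℕ := {y | y ∈ B ∧ y < x}.ncard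

/-- The partition that results from `η` when its `i`-th block `B` is replaced by the blocks
`B(π₀), B(π₁), …`, that is by the partition of `B` that `π` induces through the increasing
enumeration of `B`. If the `i`-th block is empty, the result is `η`. -/
noncomputable def fragment (η : NatPartition) (i : ℕ) (π : NatPartition) : NatPartition where
  rel x y := η.rel x y ∧
    (x ∈ η.block i → y ∈ η.block i → π.rel (posIn (η.block i) x) (posIn (η.block i) y))
  iseqv :=
    have hb : ∀ {x y}, η.rel x y → x ∈ η.block i → y ∈ η.block i := by
      intro x y h hx
      have hset : {z | η.rel z x} = {z | η.rel z y} := by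
        ext z
        exact ⟨fun hz => η.iseqv.trans hz h, fun hz => η.iseqv.trans hz (η.iseqv.symm h)⟩
      have : η.blockMin x = η.blockMin y := by rw [blockMin, blockMin, hset]
      have h' : η.blockIndex x = η.blockIndex y := by rw [blockIndex, blockIndex, this]
      exact h'.symm.trans hx
    { refl := fun x => ⟨η.iseqv.refl x, fun _ _ => π.iseqv.refl _⟩
      symm := fun h => ⟨η.iseqv.symm h.1, fun hx hy => π.iseqv.symm (h.2 hy hx)⟩
      trans := fun h h' => ⟨η.iseqv.trans h.1 h'.1, fun hx hz =>
        π.iseqv.trans (h.2 hx (hb h.1 hx)) (h'.2 (hb h.1 hx) hz)⟩ }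

/-- A function that depends only on the restriction to the first `n` integers is continuous. -/
theorem continuous_of_agreeOn {n : ℕ} {f : NatPartition → ℝ}
    (hf : ∀ η π, AgreeOn n η π → f η = f π) : Continuous f := by
  refine (IsLocallyConstant.iff_eventually_eq f).2 (fun η => ?_) |>.continuous
  have hpos : (0 : ℝ) < 1 / ((n + 1 : ℕ) : ℝ) := by positivity
  filter_upwards [Metric.ball_mem_nhds η hpos] with π hπ
  obtain ⟨m, hm, ha, hlt⟩ := exists_of_dist_lt hπ
  have h' : n + 1 < m := by
    have := (one_div_lt_one_div (by exact_mod_cast hm) (by positivity)).1 hlt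
    exact_mod_cast this
  exact hf _ _ (ha.mono (by omega))

/-- The space of functions that depend only on the restriction of the partition to the first `n`
integers. Such functions are automatically continuous, see `continuous_of_agreeOn`. -/
def D (n : ℕ) : Submodule ℝ C(NatPartition, ℝ) where
  carrier := {f | ∀ η π, AgreeOn n η π → f η = f π}
  add_mem' {f g} hf hg η π h := by simp [hf η π h, hg η π h]
  zero_mem' η π _ := rfl
  smul_mem' c f hf η π h := by simp [hf η π h]

/-- The union of the spaces `D n` over `n ≥ 1`. -/
def Dinf : Submodule ℝ C(NatPartition, ℝ) where
  carrier := {f | ∃ n : ℕ, 1 ≤ n ∧ f ∈ D n}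
  add_mem' {f g} := by
    rintro ⟨m, hm, hf⟩ ⟨n, hn, hg⟩
    refine ⟨max m n, le_max_of_le_left hm, fun η π h => ?_⟩
    simp [hf η π (h.mono (le_max_left m n)), hg η π (h.mono (le_max_right m n))]
  zero_mem' := ⟨1, le_rfl, (D 1).zero_mem⟩
  smul_mem' c f := by
    rintro ⟨n, hn, hf⟩
    exact ⟨n, hn, (D n).smul_mem c hf⟩

/-! ### The Pólya urns and the splitting rates -/

/-- The set of red balls in the urn that starts with the black balls `0, …, m - 1` and the red ball
`m`. For `n > m`, the ball `n = i + 1` receives the colour of the ball `v i`, which is one of the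
balls `0, …, i` that are in the urn at that time. -/
inductive UrnRed (m : ℕ) (v : (i : ℕ) → Fin (i + 1)) : ℕ → Prop
  | initial : UrnRed m v m
  | copy (i : ℕ) (hi : m ≤ i) (h : UrnRed m v (v i : ℕ)) : UrnRed m v (i + 1)

/-- The partition of the balls into black balls and red balls. -/
def urnPartition (m : ℕ) (v : (i : ℕ) → Fin (i + 1)) : NatPartition where
  rel x y := UrnRed m v x ↔ UrnRed m v y
  iseqv := ⟨fun _ => Iff.rfl, fun h => h.symm, fun h h' => h.trans h'⟩

/-- The uniform law on `{0, …, i}`. -/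
noncomputable def uniformLaw (i : ℕ) : Measure (Fin (i + 1)) :=
  (PMF.uniformOfFintype (Fin (i + 1))).toMeasure

instance (i : ℕ) : IsProbabilityMeasure (uniformLaw i) := by
  unfold uniformLaw; infer_instance

/-- The law of the random binary partition generated by the Pólya urn that starts with the black
balls `0, …, m - 1` and the red ball `m`; the balls `v i` are picked independently and uniformly at
random. -/
noncomputable def polyaLaw (m : ℕ) : Measure NatPartition :=
  (Measure.infinitePi uniformLaw).map (urnPartition m)

/-- The splitting rates: the sum of the laws of the Pólya urn partitions with `m ≥ 1` initial black
balls. -/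
noncomputable def splittingRate : Measure NatPartition :=
  Measure.sum fun m : ℕ => polyaLaw (m + 1)

end NatPartition

/-! ### The destruction of the infinite random recursive tree -/

/-- `u i` is the parent of the vertex `i + 1`, and `e i` is the time at which the edge that joins
the vertex `i + 1` to its parent is removed. The parents are independent and uniformly distributed
on the smaller vertices, the removal times are independent standard exponential variables, and
they are independent of the tree. -/
structure IsTreeDestruction {Ω : Type*} [MeasurableSpace Ω] (μ : Measure Ω)
    (u : (i : ℕ) → Ω → Fin (i + 1)) (e : ℕ → Ω → ℝ) : Prop where
  measurable_parent : ∀ i, Measurable (u i)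
  measurable_time : ∀ i, Measurable (e i)
  law_parent : ∀ i, μ.map (u i) = NatPartition.uniformLaw i
  law_time : ∀ i, μ.map (e i) = expMeasure 1
  indep_parent : iIndepFun u μ
  indep_time : iIndepFun e μ
  indep : IndepFun (fun ω i => u i ω) (fun ω i => e i ω) μ

/-- The forest with vertex set `ℕ` that is left at time `t`: the vertex `i + 1` is joined to its
parent as long as the removal time of that edge is larger than `t`. -/
def remainingForest (parent : (i : ℕ) → Fin (i + 1)) (removal : ℕ → ℝ) (t : ℝ≥0) : SimpleGraph ℕ :=
  SimpleGraph.fromRel fun x y => ∃ i, x = i + 1 ∧ y = (parent i : ℕ) ∧ (t : ℝ) < removal i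

/-- The destruction process: at time `t`, the partition of the set of vertices into the connected
components of the forest that is left. -/
def destruction {Ω : Type*} (u : (i : ℕ) → Ω → Fin (i + 1)) (e : ℕ → Ω → ℝ) (t : ℝ≥0) (ω : Ω) :
    NatPartition where
  rel := (remainingForest (fun i => u i ω) (fun i => e i ω) t).Reachable
  iseqv := SimpleGraph.reachable_is_equivalence _

/-! ### Feller semigroups on a compact space -/

/-- A (conservative) Feller semigroup on a compact space: a strongly continuous semigroup of
positive linear operators on the space of continuous functions that preserve constants. -/
@[ext]
structure FellerSemigroup (E : Type*) [TopologicalSpace E] [CompactSpace E] where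
  op : ℝ≥0 → C(E, ℝ) →L[ℝ] C(E, ℝ)
  op_zero : op 0 = ContinuousLinearMap.id ℝ C(E, ℝ)
  op_add : ∀ s t, op (s + t) = (op s).comp (op t)
  op_nonneg : ∀ t f, 0 ≤ f → 0 ≤ op t f
  op_one : ∀ t, op t 1 = 1
  tendsto_zero : ∀ f, Tendsto (fun t => op t f) (𝓝 0) (𝓝 f)

namespace FellerSemigroup

variable {E : Type*} [TopologicalSpace E] [CompactSpace E]

/-- `g` is the limit in `C(E)` of `(T_t f - f) / t` as `t` decreases to `0`. -/
def HasGenerator (T : FellerSemigroup E) (f g : C(E, ℝ)) : Prop :=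
  Tendsto (fun t : ℝ≥0 => (t : ℝ)⁻¹ • (T.op t f - f)) (𝓝[>] 0) (𝓝 g)

theorem HasGenerator.add {T : FellerSemigroup E} {f g f' g' : C(E, ℝ)}
    (h : T.HasGenerator f g) (h' : T.HasGenerator f' g') :
    T.HasGenerator (f + f') (g + g') := by
  refine (Tendsto.add h h').congr fun t => ?_
  rw [map_add, ← smul_add]
  congr 1
  abel

theorem HasGenerator.smul {T : FellerSemigroup E} {f g : C(E, ℝ)} (c : ℝ)
    (h : T.HasGenerator f g) : T.HasGenerator (c • f) (c • g) := by
  refine (Tendsto.const_smul h c).congr fun t => ?_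
  rw [map_smul, ← smul_sub, smul_comm]

theorem HasGenerator.unique {T : FellerSemigroup E} {f g g' : C(E, ℝ)}
    (h : T.HasGenerator f g) (h' : T.HasGenerator f g') : g = g' :=
  tendsto_nhds_unique h h'

/-- The infinitesimal generator, as an unbounded operator on `C(E)`. Its domain is the set of all
`f` for which the limit of `(T_t f - f) / t` as `t` decreases to `0` exists in `C(E)`. -/
noncomputable def generator (T : FellerSemigroup E) : C(E, ℝ) →ₗ.[ℝ] C(E, ℝ) where
  domain :=
    { carrier := {f | ∃ g, T.HasGenerator f g}
      add_mem' := fun ⟨g, h⟩ ⟨g', h'⟩ => ⟨g + g', h.add h'⟩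
      zero_mem' := ⟨0, by simp [HasGenerator]⟩
      smul_mem' := fun c _ ⟨g, h⟩ => ⟨c • g, h.smul c⟩ }
  toFun :=
    { toFun := fun f => f.2.choose
      map_add' := fun f f' =>
        (f + f').2.choose_spec.unique (f.2.choose_spec.add f'.2.choose_spec)
      map_smul' := fun c f => (c • f).2.choose_spec.unique (f.2.choose_spec.smul c) }

end FellerSemigroup

/-- The σ-algebra generated by the random variables `X r` for `r ≤ s`. -/
@[reducible]
def pastSigma {Ω E : Type*} [MeasurableSpace E] (X : ℝ≥0 → Ω → E) (s : ℝ≥0) : MeasurableSpace Ω :=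
  ⨆ r : Set.Iic s, MeasurableSpace.comap (X r) inferInstance

/-- `X` is, under `μ`, a Markov process (in its natural filtration) with semigroup `T`:
`E[f (X (s + t)) | σ(X r, r ≤ s)] = T_t f (X s)` almost surely for every continuous `f`. -/
structure IsMarkovWith {Ω E : Type*} [MeasurableSpace Ω] [TopologicalSpace E] [CompactSpace E]
    [MeasurableSpace E] (μ : Measure Ω) (X : ℝ≥0 → Ω → E) (T : FellerSemigroup E) : Prop where
  measurable : ∀ t, Measurable (X t)
  condExp_eq : ∀ (s t : ℝ≥0) (f : C(E, ℝ)),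
    μ[fun ω => f (X (s + t) ω) | pastSigma X s] =ᵐ[μ] fun ω => T.op t f (X s ω)

/-!
The proof rests on one recursion. Consider the restriction of the process to the vertices `0, …, n`.
The vertex `n` hangs on a uniform smaller vertex through an edge with an exponential clock, and is
never the parent of a smaller vertex. Hence, given the fragmentation of the smaller vertices, it is
either cut off (with probability `1 - exp (-t)` after a time `t`), or belongs to the block of its
parent. Starting from a partition `η`, the parent is uniform among the smaller elements of the block
of `n` (`avg`), and this defines the expectation `semi t n η g` of `g` at time `t` by recursion on
the number of vertices.

*Markov property.* `IsTreeDestruction.integral_part_mul` shows by induction on the number of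
vertices that the destruction of a finite tree is Markovian with the transition operators
`semi t n`. The last vertex is integrated out: by the lack of memory of its clock, what matters is
that its parent, given the past of the other vertices, may be replaced by a uniform element of the
block of the parent at the present time, because the past depends on the parent only through that
block (`sum_mul_class_mean`). The partition of the infinite tree, restricted to finitely many
vertices, is that of a finite tree (`part_rel_iff_reachable`), and letting the number of vertices
tend to infinity gives the Markov property with operators `transOp` on `C(NatPartition, ℝ)`
(`IsTreeDestruction.condExp_destruction`). Functions in `D n` only need `n` vertices, so that `D n`
is invariant.

*Semigroup property and uniqueness.* At a positive time, the process is in any given nonempty open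
set with positive probability (`semi_pos`), so a continuous function is determined by its values
along the process (`IsTreeDestruction.eq_of_ae_eq`). The conditional expectations therefore
determine the operators, and the tower property turns into the semigroup property.

*Core.* On the finite dimensional space `D n`, the generator is the derivative `gen n` of `semi t n`
at `t = 0`. As generators are dissipative, `1 - G` is injective on `D n`, hence surjective, and this
makes the dense space `Dinf` a core of the closed operator `G` (`FellerSemigroup.hasCore_of_dense`).

*Formula for the generator.* The integral against the splitting rates satisfies the same recursion
as `gen`: if `n` has `b` smaller elements in its block, then, in the urn that splits this block, `n`
is the ball number `b`. This ball copies the colour of a uniform earlier one if there are fewer than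
`b` initial black balls, is the first red one if there are `b` of them, and is black like all the
earlier ones otherwise (`integral_last_increment`). Summing over the urns gives `integral_splitSum`.
-/

namespace NatPartition

/-! ### Adding vertices to a finite partition -/

/-- The partition into singletons. -/
def discrete : NatPartition := ⟨fun x y => x = y, eq_equivalence⟩

/-- The partition `σ` with `m` moved to the block of `j`: every occurrence of `m` is read as `j`. -/
def attach (σ : NatPartition) (m j : ℕ) : NatPartition where
  rel x y := σ.rel (if x = m then j else x) (if y = m then j else y)
  iseqv := ⟨fun _ => σ.iseqv.refl _, fun h => σ.iseqv.symm h, fun h h' => σ.iseqv.trans h h'⟩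

/-- The partition that coincides with `η` on the first `n` integers and has all other integers as
singletons. -/
def trunc (n : ℕ) (η : NatPartition) : NatPartition where
  rel x y := x = y ∨ (x < n ∧ y < n ∧ η.rel x y)
  iseqv :=
    { refl := fun _ => Or.inl rfl
      symm := by
        rintro x y (rfl | ⟨h1, h2, h⟩)
        · exact Or.inl rfl
        · exact Or.inr ⟨h2, h1, η.iseqv.symm h⟩
      trans := by
        rintro x y z (rfl | ⟨h1, h2, h⟩) (rfl | ⟨h3, h4, h'⟩)
        · exact Or.inl rfl
        · exact Or.inr ⟨h3, h4, h'⟩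
        · exact Or.inr ⟨h1, h2, h⟩
        · exact Or.inr ⟨h1, h4, η.iseqv.trans h h'⟩ }

open Classical in
/-- The elements smaller than `n` in the block of `n`. -/
noncomputable def earlier (η : NatPartition) (n : ℕ) : Finset ℕ :=
  (Finset.range n).filter fun j => η.rel j n

/-- Every integer from `n` on is a singleton of `σ`. -/
def IsolatedFrom (n : ℕ) (σ : NatPartition) : Prop := ∀ x y, n ≤ x → σ.rel x y → x = y

theorem mem_earlier {η : NatPartition} {n j : ℕ} : j ∈ η.earlier n ↔ j < n ∧ η.rel j n := by
  simp [earlier]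

theorem AgreeOn.earlier_eq {n : ℕ} {η π : NatPartition} (h : AgreeOn (n + 1) η π) :
    η.earlier n = π.earlier n := by
  ext j
  rw [mem_earlier, mem_earlier]
  exact and_congr_right fun hj => h j (by omega) n (by omega)

theorem trunc_agreeOn (n : ℕ) (η : NatPartition) : AgreeOn n (trunc n η) η := by
  intro i hi j hj
  constructor
  · rintro (rfl | ⟨-, -, h⟩)
    · exact η.iseqv.refl _
    · exact h
  · exact fun h => Or.inr ⟨hi, hj, h⟩

theorem AgreeOn.trunc_eq {n : ℕ} {η π : NatPartition} (h : AgreeOn n η π) :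
    trunc n η = trunc n π := by
  ext x y
  exact or_congr_right (and_congr_right fun hx => and_congr_right fun hy => h x hx y hy)

theorem trunc_zero (η : NatPartition) : trunc 0 η = discrete := by
  ext x y
  simp [trunc, discrete]

theorem isolatedFrom_discrete (n : ℕ) : IsolatedFrom n discrete := fun _ _ _ h => h

theorem IsolatedFrom.mono {m n : ℕ} (hmn : m ≤ n) {σ : NatPartition} (h : IsolatedFrom m σ) :
    IsolatedFrom n σ := fun x y hx => h x y (hmn.trans hx)

theorem IsolatedFrom.earlier_eq {n : ℕ} {σ : NatPartition} (h : IsolatedFrom n σ) :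
    σ.earlier n = ∅ := by
  ext j
  simp only [mem_earlier, Finset.notMem_empty, iff_false, not_and]
  intro hj hr
  have := h n j le_rfl (σ.iseqv.symm hr)
  omega

theorem attach_agreeOn (σ : NatPartition) (n j : ℕ) : AgreeOn n (attach σ n j) σ := by
  intro x hx y hy
  simp only [attach]
  rw [if_neg (by omega), if_neg (by omega)]

theorem IsolatedFrom.attach {n j : ℕ} (hj : j < n) {σ : NatPartition} (h : IsolatedFrom n σ) :
    IsolatedFrom (n + 1) (attach σ n j) := by
  intro x y hx hr
  simp only [NatPartition.attach] at hr
  rw [if_neg (by omega)] at hr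
  split_ifs at hr with hy
  · have := h x j (by omega) hr
    omega
  · exact h x y (by omega) hr

theorem attach_eq_of_rel {σ : NatPartition} {n j k : ℕ} (h : σ.rel j k) :
    attach σ n j = attach σ n k := by
  have key : ∀ x, σ.rel (if x = n then j else x) (if x = n then k else x) := by
    intro x
    split_ifs
    · exact h
    · exact σ.iseqv.refl x
  ext x y
  exact ⟨fun hr => σ.iseqv.trans (σ.iseqv.symm (key x)) (σ.iseqv.trans hr (key y)),
    fun hr => σ.iseqv.trans (key x) (σ.iseqv.trans hr (σ.iseqv.symm (key y)))⟩

/-- After attaching `n` to `j`, the elements below `n` in the block of `n` are those in the block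
of `j`. -/
theorem mem_earlier_attach {σ : NatPartition} {n j k : ℕ} :
    k ∈ (attach σ n j).earlier n ↔ k < n ∧ σ.rel k j := by
  rw [mem_earlier]
  refine and_congr_right fun hk => ?_
  simp only [attach]
  rw [if_neg (by omega), if_pos trivial]

theorem attach_trunc {η : NatPartition} {n j : ℕ} (hj : j ∈ η.earlier n) :
    attach (trunc n η) n j = trunc (n + 1) η := by
  obtain ⟨hjn, hr⟩ := mem_earlier.1 hj
  have key : ∀ y, η.rel (if y = n then j else y) y := by
    intro y
    split_ifs with h
    · exact h ▸ hr
    · exact η.iseqv.refl y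
  ext x y
  have hiff : η.rel (if x = n then j else x) (if y = n then j else y) ↔ η.rel x y :=
    ⟨fun h => η.iseqv.trans (η.iseqv.symm (key x)) (η.iseqv.trans h (key y)),
      fun h => η.iseqv.trans (key x) (η.iseqv.trans h (η.iseqv.symm (key y)))⟩
  simp only [attach, trunc]
  rw [hiff]
  by_cases hx : x = n <;> by_cases hy : y = n
  · subst hx; subst hy; simp
  · subst hx
    simp only [if_pos, if_neg hy, hjn, true_and]
    constructor
    · rintro (rfl | ⟨h, h'⟩)
      · exact Or.inr ⟨by omega, by omega, η.iseqv.symm hr⟩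
      · exact Or.inr ⟨by omega, by omega, h'⟩
    · rintro (rfl | ⟨h, h1, h'⟩)
      · exact absurd rfl hy
      · exact Or.inr ⟨by omega, h'⟩
  · subst hy
    simp only [if_neg hx, if_pos, hjn, true_and]
    constructor
    · rintro (rfl | ⟨h, h'⟩)
      · exact Or.inr ⟨by omega, by omega, hr⟩
      · exact Or.inr ⟨by omega, by omega, h'⟩
    · rintro (rfl | ⟨h, h1, h'⟩)
      · exact absurd rfl hx
      · exact Or.inr ⟨by omega, h'⟩
  · rw [if_neg hx, if_neg hy]
    refine or_congr_right ⟨fun ⟨h1, h2, h3⟩ => ⟨by omega, by omega, h3⟩,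
      fun ⟨h1, h2, h3⟩ => ⟨by omega, by omega, h3⟩⟩

theorem trunc_succ_of_earlier_eq_empty {η : NatPartition} {n : ℕ} (h : η.earlier n = ∅) :
    trunc (n + 1) η = trunc n η := by
  have hn : ∀ j < n, ¬ η.rel j n := fun j hj hr => by
    have := mem_earlier.2 ⟨hj, hr⟩
    simp [h] at this
  ext x y
  simp only [trunc]
  constructor
  · rintro (rfl | ⟨hx, hy, hr⟩)
    · exact Or.inl rfl
    · rcases Nat.lt_succ_iff_lt_or_eq.1 hx with hx | rfl <;>
      rcases Nat.lt_succ_iff_lt_or_eq.1 hy with hy | rfl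
      · exact Or.inr ⟨hx, hy, hr⟩
      · exact absurd hr (hn x hx)
      · exact absurd (η.iseqv.symm hr) (hn y hy)
      · exact Or.inl rfl
  · rintro (rfl | ⟨hx, hy, hr⟩)
    · exact Or.inl rfl
    · exact Or.inr ⟨by omega, by omega, hr⟩

theorem finite_range_trunc (n : ℕ) : (Set.range (trunc n)).Finite := by
  classical
  let F : NatPartition → (Fin n → Fin n → Prop) := fun η i j => η.rel i j
  have hF : ∀ η π, F η = F π → trunc n η = trunc n π := fun η π h =>
    AgreeOn.trunc_eq fun i hi j hj => iff_of_eq (congr_fun (congr_fun h ⟨i, hi⟩) ⟨j, hj⟩)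
  refine (Set.finite_range (fun a : Fin n → Fin n → Prop =>
    if h : ∃ η, F η = a then trunc n h.choose else discrete)).subset ?_
  rintro _ ⟨η, rfl⟩
  have h : ∃ π, F π = F η := ⟨η, rfl⟩
  exact ⟨F η, (dif_pos h).trans (hF _ _ h.choose_spec)⟩

/-! ### The transition operators on finitely many vertices -/

open Classical in
/-- The mean of `g` over the partitions that result from attaching `n` to a uniformly chosen smaller
element of its block in `η`. If there is no such element, `n` is left as it is. -/
noncomputable def avg (η : NatPartition) (n : ℕ) :
    (NatPartition → ℝ) →ₗ[ℝ] (NatPartition → ℝ) :=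
  if (η.earlier n).Nonempty then
    ((η.earlier n).card : ℝ)⁻¹ • ∑ j ∈ η.earlier n, LinearMap.funLeft ℝ ℝ fun σ => attach σ n j
  else LinearMap.id

/-- `semi t n η g` is the expectation of `g` at the partition of the first `n` vertices (the others
being singletons) that results from destroying, up to time `t`, independent random recursive trees
on the blocks of `η`. The vertex `n` is separated from its parent with probability `1 - exp (-t)`,
and otherwise belongs to the block of a uniform smaller element of its block in `η`. -/
noncomputable def semi (t : ℝ) : ℕ → NatPartition → ((NatPartition → ℝ) →ₗ[ℝ] ℝ)
  | 0, _ => LinearMap.proj discrete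
  | n + 1, η => (1 - Real.exp (-t)) • semi t n η + Real.exp (-t) • (semi t n η).comp (avg η n)

/-- The derivative of `t ↦ semi t n η` at `0`, see `hasDerivAt_semi`. -/
noncomputable def gen : ℕ → NatPartition → ((NatPartition → ℝ) →ₗ[ℝ] ℝ)
  | 0, _ => 0
  | n + 1, η => (gen n η).comp (avg η n) + LinearMap.proj (trunc n η) -
      LinearMap.proj (trunc (n + 1) η)

theorem avg_apply_of_nonempty {η : NatPartition} {n : ℕ} (h : (η.earlier n).Nonempty)
    (g : NatPartition → ℝ) (σ : NatPartition) :
    avg η n g σ = ((η.earlier n).card : ℝ)⁻¹ * ∑ j ∈ η.earlier n, g (attach σ n j) := by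
  simp [avg, h, LinearMap.funLeft, LinearMap.sum_apply, Finset.sum_apply]

theorem avg_of_earlier_eq_empty {η : NatPartition} {n : ℕ} (h : η.earlier n = ∅)
    (g : NatPartition → ℝ) : avg η n g = g := by
  simp [avg, h]

theorem semi_zero_apply (t : ℝ) (η : NatPartition) (g : NatPartition → ℝ) :
    semi t 0 η g = g discrete := rfl

theorem semi_succ_apply (t : ℝ) (n : ℕ) (η : NatPartition) (g : NatPartition → ℝ) :
    semi t (n + 1) η g =
      (1 - Real.exp (-t)) * semi t n η g + Real.exp (-t) * semi t n η (avg η n g) := rfl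

theorem gen_succ_apply (n : ℕ) (η : NatPartition) (g : NatPartition → ℝ) :
    gen (n + 1) η g = gen n η (avg η n g) + g (trunc n η) - g (trunc (n + 1) η) := rfl

theorem avg_const (η : NatPartition) (n : ℕ) (c : ℝ) :
    avg η n (fun _ => c) = fun _ => c := by
  rcases (η.earlier n).eq_empty_or_nonempty with h | h
  · exact avg_of_earlier_eq_empty h _
  · ext σ
    have : ((η.earlier n).card : ℝ) ≠ 0 := by exact_mod_cast h.card_pos.ne'
    rw [avg_apply_of_nonempty h, Finset.sum_const, nsmul_eq_mul]
    field_simp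

theorem avg_nonneg (η : NatPartition) (n : ℕ) {g : NatPartition → ℝ} (hg : ∀ σ, 0 ≤ g σ)
    (σ : NatPartition) : 0 ≤ avg η n g σ := by
  rcases (η.earlier n).eq_empty_or_nonempty with h | h
  · rw [avg_of_earlier_eq_empty h]
    exact hg σ
  · rw [avg_apply_of_nonempty h]
    exact mul_nonneg (by positivity) (Finset.sum_nonneg fun j _ => hg _)

theorem avg_trunc (η : NatPartition) (n : ℕ) (g : NatPartition → ℝ) :
    avg η n g (trunc n η) = g (trunc (n + 1) η) := by
  rcases (η.earlier n).eq_empty_or_nonempty with h | h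
  · rw [avg_of_earlier_eq_empty h, trunc_succ_of_earlier_eq_empty h]
  · have : ((η.earlier n).card : ℝ) ≠ 0 := by exact_mod_cast h.card_pos.ne'
    rw [avg_apply_of_nonempty h, Finset.sum_congr rfl fun j hj => by rw [attach_trunc hj],
      Finset.sum_const, nsmul_eq_mul]
    field_simp

theorem AgreeOn.avg_eq {n : ℕ} {η π : NatPartition} (h : AgreeOn (n + 1) η π) :
    avg η n = avg π n := by
  simp only [avg, h.earlier_eq]

theorem avg_eq_self {n : ℕ} {g : NatPartition → ℝ} (hg : ∀ σ τ, AgreeOn n σ τ → g σ = g τ)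
    (η : NatPartition) : avg η n g = g := by
  rcases (η.earlier n).eq_empty_or_nonempty with h | h
  · exact avg_of_earlier_eq_empty h _
  · ext σ
    have : ((η.earlier n).card : ℝ) ≠ 0 := by exact_mod_cast h.card_pos.ne'
    rw [avg_apply_of_nonempty h, Finset.sum_congr rfl fun j _ => hg _ _ (attach_agreeOn σ n j),
      Finset.sum_const, nsmul_eq_mul]
    field_simp

theorem AgreeOn.semi_eq {n : ℕ} {η π : NatPartition} (h : AgreeOn n η π) (t : ℝ) :
    semi t n η = semi t n π := by
  induction n with
  | zero => rfl
  | succ n ih => simp only [semi, ih (h.mono n.le_succ), h.avg_eq]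

theorem AgreeOn.gen_eq {n : ℕ} {η π : NatPartition} (h : AgreeOn n η π) :
    gen n η = gen n π := by
  induction n with
  | zero => rfl
  | succ n ih =>
    have h' := h.mono n.le_succ
    simp only [gen, ih h', h.avg_eq, h.trunc_eq, h'.trunc_eq]

theorem semi_const (t : ℝ) (n : ℕ) (η : NatPartition) (c : ℝ) :
    semi t n η (fun _ => c) = c := by
  induction n with
  | zero => rfl
  | succ n ih => rw [semi_succ_apply, avg_const, ih]; ring

theorem one_sub_exp_neg_nonneg {t : ℝ} (ht : 0 ≤ t) : 0 ≤ 1 - Real.exp (-t) :=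
  sub_nonneg.2 (Real.exp_le_one_iff.2 (by linarith))

theorem semi_nonneg {t : ℝ} (ht : 0 ≤ t) (n : ℕ) (η : NatPartition) {g : NatPartition → ℝ}
    (hg : ∀ σ, 0 ≤ g σ) : 0 ≤ semi t n η g := by
  induction n generalizing g with
  | zero => exact hg _
  | succ n ih =>
    exact add_nonneg (mul_nonneg (one_sub_exp_neg_nonneg ht) (ih hg))
      (mul_nonneg (Real.exp_pos _).le (ih (avg_nonneg η n hg)))

theorem abs_semi_le {t : ℝ} (ht : 0 ≤ t) (n : ℕ) (η : NatPartition) {g : NatPartition → ℝ}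
    {C : ℝ} (hg : ∀ σ, |g σ| ≤ C) : |semi t n η g| ≤ C := by
  have h1 := semi_nonneg ht n η (g := (fun _ => C) - g)
    fun σ => sub_nonneg.2 (abs_le.1 (hg σ)).2
  have h2 := semi_nonneg ht n η (g := (fun _ => C) + g)
    fun σ => by have := (abs_le.1 (hg σ)).1; simp only [Pi.add_apply]; linarith
  rw [map_sub, semi_const] at h1
  rw [map_add, semi_const] at h2
  exact abs_le.2 ⟨by linarith, by linarith⟩

theorem semi_eq_of_le {m n : ℕ} (hmn : m ≤ n) {g : NatPartition → ℝ}
    (hg : ∀ σ τ, AgreeOn m σ τ → g σ = g τ) (t : ℝ) (η : NatPartition) :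
    semi t n η g = semi t m η g := by
  induction n, hmn using Nat.le_induction with
  | base => rfl
  | succ n hmn ih =>
    rw [semi_succ_apply, avg_eq_self fun σ τ h => hg σ τ (h.mono hmn), ih]
    ring

theorem semi_at_zero (n : ℕ) (η : NatPartition) (g : NatPartition → ℝ) :
    semi 0 n η g = g (trunc n η) := by
  induction n generalizing g with
  | zero => rw [semi_zero_apply, trunc_zero]
  | succ n ih => rw [semi_succ_apply, ih, ih, avg_trunc]; simp

theorem hasDerivAt_semi (n : ℕ) (η : NatPartition) (g : NatPartition → ℝ) :
    HasDerivAt (fun t => semi t n η g) (gen n η g) 0 := by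
  induction n generalizing g with
  | zero => exact hasDerivAt_const _ _
  | succ n ih =>
    have he : HasDerivAt (fun t : ℝ => Real.exp (-t)) (-1) 0 := by
      simpa using (hasDerivAt_neg (0 : ℝ)).exp
    have h := ((he.const_sub 1).mul (ih g)).add (he.mul (ih (avg η n g)))
    refine HasDerivAt.congr_deriv h ?_
    rw [gen_succ_apply, semi_at_zero, semi_at_zero, avg_trunc]
    simp
    ring

/-- If `η` has a single block, then every partition of the first `n` vertices is reached with
positive probability at positive times. -/
theorem semi_pos {t : ℝ} (ht : 0 < t) {η : NatPartition} (hη : ∀ x y, η.rel x y)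
    (π : NatPartition) (n : ℕ) {g : NatPartition → ℝ} (hg : ∀ σ, 0 ≤ g σ)
    (hpos : 0 < g (trunc n π)) : 0 < semi t n η g := by
  induction n generalizing g with
  | zero => rw [semi_zero_apply, ← trunc_zero π]; exact hpos
  | succ n ih =>
    have h1 : 0 < 1 - Real.exp (-t) := sub_pos.2 (by rw [Real.exp_lt_one_iff]; linarith)
    have h2 := Real.exp_pos (-t)
    have h3 := semi_nonneg ht.le n η hg
    have h4 := semi_nonneg ht.le n η (avg_nonneg η n hg)
    rw [semi_succ_apply]
    rcases (π.earlier n).eq_empty_or_nonempty with h | ⟨j, hj⟩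
    · rw [trunc_succ_of_earlier_eq_empty h] at hpos
      have := ih hg hpos
      positivity
    · have hj' : j ∈ η.earlier n := mem_earlier.2 ⟨(mem_earlier.1 hj).1, hη _ _⟩
      have : 0 < semi t n η (avg η n g) := by
        refine ih (avg_nonneg η n hg) ?_
        rw [avg_apply_of_nonempty ⟨j, hj'⟩]
        have hc : (0 : ℝ) < (η.earlier n).card := by
          exact_mod_cast Finset.card_pos.2 ⟨j, hj'⟩
        refine mul_pos (inv_pos.2 hc) ((hpos.trans_eq (by rw [← attach_trunc hj])).trans_le ?_)
        exact Finset.single_le_sum (f := fun k => g (attach (trunc n π) n k))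
          (fun k _ => hg _) hj'
      positivity

end NatPartition

namespace NatPartition

/-! ### The operators on continuous functions -/

/-- A function of the restriction to the first `n` integers, as an element of `D n`. -/
def ofAgreeOn (n : ℕ) (g : NatPartition → ℝ) (hg : ∀ η π, AgreeOn n η π → g η = g π) :
    C(NatPartition, ℝ) := ⟨g, continuous_of_agreeOn hg⟩

theorem ofAgreeOn_apply {n : ℕ} {g : NatPartition → ℝ}
    (hg : ∀ η π, AgreeOn n η π → g η = g π) (η : NatPartition) : ofAgreeOn n g hg η = g η := rfl

theorem ofAgreeOn_mem {n : ℕ} {g : NatPartition → ℝ}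
    (hg : ∀ η π, AgreeOn n η π → g η = g π) : ofAgreeOn n g hg ∈ D n := hg

theorem apply_trunc_of_mem_D {n : ℕ} {f : C(NatPartition, ℝ)} (hf : f ∈ D n) (η : NatPartition) :
    f (trunc n η) = f η := hf _ _ (trunc_agreeOn n η)

/-- Continuous functions are uniform limits of functions in `Dinf`. -/
theorem exists_mem_D_norm_sub_lt (f : C(NatPartition, ℝ)) {r : ℝ} (hr : 0 < r) :
    ∃ n, 1 ≤ n ∧ ∃ g ∈ D n, ‖f - g‖ < r := by
  obtain ⟨d, hd, h⟩ := Metric.uniformContinuous_iff.1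
    (CompactSpace.uniformContinuous_of_continuous f.continuous) (r / 2) (half_pos hr)
  obtain ⟨n, hn⟩ := exists_nat_one_div_lt hd
  refine ⟨n + 1, by omega, ofAgreeOn (n + 1) (fun η => f (trunc (n + 1) η))
    (fun η π hηπ => by rw [hηπ.trunc_eq]), ofAgreeOn_mem _, ?_⟩
  refine lt_of_le_of_lt ((ContinuousMap.norm_le _ (half_pos hr).le).2 fun η => ?_) (half_lt_self hr)
  rw [ContinuousMap.sub_apply, ofAgreeOn_apply, ← dist_eq_norm]
  refine (h ?_).le
  have := dist_le_of_agreeOn (by omega) (trunc_agreeOn (n + 1) η).symm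
  push_cast at this
  exact this.trans_lt hn

theorem dense_Dinf : Dense (Dinf : Set C(NatPartition, ℝ)) := by
  refine Metric.dense_iff.2 fun f r hr => ?_
  obtain ⟨n, hn, g, hg, h⟩ := exists_mem_D_norm_sub_lt f hr
  exact ⟨g, by rwa [Metric.mem_ball, dist_comm, dist_eq_norm], n, hn, hg⟩

/-- The operator `semi t n` on continuous functions. -/
noncomputable def semiOp (t : ℝ≥0) (n : ℕ) : C(NatPartition, ℝ) →L[ℝ] C(NatPartition, ℝ) :=
  LinearMap.mkContinuous
    { toFun := fun f => ofAgreeOn n (fun η => semi t n η f) fun η π h => by rw [h.semi_eq]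
      map_add' := fun f g => by
        ext η
        simp only [ofAgreeOn_apply, ContinuousMap.add_apply, ContinuousMap.coe_add, map_add]
      map_smul' := fun c f => by
        ext η
        simp only [ofAgreeOn_apply, ContinuousMap.smul_apply, ContinuousMap.coe_smul, map_smul,
          RingHom.id_apply] }
    1 fun f => by
      rw [one_mul]
      exact (ContinuousMap.norm_le _ (norm_nonneg _)).2 fun η =>
        abs_semi_le t.2 n η fun σ => f.norm_coe_le_norm σ

theorem semiOp_apply (t : ℝ≥0) (n : ℕ) (f : C(NatPartition, ℝ)) (η : NatPartition) :
    semiOp t n f η = semi t n η f := rfl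

theorem semiOp_mem_D (t : ℝ≥0) (n : ℕ) (f : C(NatPartition, ℝ)) : semiOp t n f ∈ D n :=
  fun η π h => by rw [semiOp_apply, semiOp_apply, h.semi_eq]

theorem norm_semiOp_le (t : ℝ≥0) (n : ℕ) (f : C(NatPartition, ℝ)) : ‖semiOp t n f‖ ≤ ‖f‖ :=
  (ContinuousMap.norm_le _ (norm_nonneg _)).2 fun η =>
    abs_semi_le t.2 n η fun σ => f.norm_coe_le_norm σ

theorem semiOp_eq_of_le {m n : ℕ} (hmn : m ≤ n) (t : ℝ≥0) {f : C(NatPartition, ℝ)}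
    (hf : f ∈ D m) : semiOp t n f = semiOp t m f := by
  ext η
  exact semi_eq_of_le hmn hf t η

theorem exists_tendsto_semiOp (t : ℝ≥0) (f : C(NatPartition, ℝ)) :
    ∃ g, Tendsto (fun n => semiOp t n f) atTop (𝓝 g) := by
  refine cauchySeq_tendsto_of_complete (Metric.cauchySeq_iff'.2 fun r hr => ?_)
  obtain ⟨N, -, g, hg, h⟩ := exists_mem_D_norm_sub_lt f (half_pos hr)
  refine ⟨N, fun n hn => ?_⟩
  have h1 : semiOp t n f - semiOp t N f = semiOp t n (f - g) - semiOp t N (f - g) := by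
    rw [map_sub, map_sub, semiOp_eq_of_le hn t hg]
    abel
  rw [dist_eq_norm, h1]
  have h2 := norm_semiOp_le t n (f - g)
  have h3 := norm_semiOp_le t N (f - g)
  have h4 := norm_sub_le (semiOp t n (f - g)) (semiOp t N (f - g))
  linarith

/-- The transition operators of the destruction process: the limit of `semiOp t n` as the number
`n` of vertices tends to infinity. -/
noncomputable def transOp (t : ℝ≥0) : C(NatPartition, ℝ) →L[ℝ] C(NatPartition, ℝ) :=
  continuousLinearMapOfTendsto (fun n => semiOp t n)
    (f := fun f => (exists_tendsto_semiOp t f).choose)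
    (tendsto_pi_nhds.2 fun f => (exists_tendsto_semiOp t f).choose_spec)

theorem tendsto_semiOp (t : ℝ≥0) (f : C(NatPartition, ℝ)) :
    Tendsto (fun n => semiOp t n f) atTop (𝓝 (transOp t f)) :=
  (exists_tendsto_semiOp t f).choose_spec

theorem transOp_eq_semiOp {n : ℕ} (t : ℝ≥0) {f : C(NatPartition, ℝ)} (hf : f ∈ D n) :
    transOp t f = semiOp t n f :=
  tendsto_nhds_unique (tendsto_semiOp t f) (tendsto_const_nhds.congr'
    ((eventually_ge_atTop n).mono fun _ hm => (semiOp_eq_of_le hm t hf).symm))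

theorem transOp_mem_D {n : ℕ} (t : ℝ≥0) {f : C(NatPartition, ℝ)} (hf : f ∈ D n) :
    transOp t f ∈ D n := by
  rw [transOp_eq_semiOp t hf]
  exact semiOp_mem_D t n f

theorem norm_transOp_le (t : ℝ≥0) (f : C(NatPartition, ℝ)) : ‖transOp t f‖ ≤ ‖f‖ :=
  le_of_tendsto (tendsto_semiOp t f).norm (Eventually.of_forall fun n => norm_semiOp_le t n f)

theorem tendsto_semi (t : ℝ≥0) (f : C(NatPartition, ℝ)) (η : NatPartition) :
    Tendsto (fun n => semi t n η f) atTop (𝓝 (transOp t f η)) :=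
  ((continuous_eval_const η).tendsto (transOp t f)).comp (tendsto_semiOp t f)

theorem transOp_nonneg (t : ℝ≥0) (f : C(NatPartition, ℝ)) (hf : 0 ≤ f) : 0 ≤ transOp t f :=
  fun η => ge_of_tendsto (tendsto_semi t f η)
    (Eventually.of_forall fun n => semi_nonneg t.2 n η hf)

theorem transOp_one (t : ℝ≥0) : transOp t 1 = 1 := by
  ext η
  exact tendsto_nhds_unique (tendsto_semi t 1 η)
    (tendsto_const_nhds.congr fun n => (semi_const t n η 1).symm)

/-- On `Dinf`, `transOp 0` is the identity; the general case follows by density. -/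
theorem transOp_zero : transOp 0 = ContinuousLinearMap.id ℝ C(NatPartition, ℝ) := by
  refine DFunLike.coe_injective (Continuous.ext_on dense_Dinf (transOp 0).continuous
    (ContinuousLinearMap.id ℝ _).continuous ?_)
  rintro f ⟨n, -, hf⟩
  ext η
  rw [transOp_eq_semiOp 0 hf, semiOp_apply, NNReal.coe_zero, semi_at_zero]
  exact apply_trunc_of_mem_D hf η

/-- Pointwise convergence of functions in `D n` is uniform, since they are determined by their
values on a finite set. -/
theorem tendsto_of_mem_D {ι : Type*} {l : Filter ι} {n : ℕ} {F : ι → C(NatPartition, ℝ)}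
    {f : C(NatPartition, ℝ)} (hF : ∀ i, F i ∈ D n) (hf : f ∈ D n)
    (h : ∀ η, Tendsto (fun i => F i η) l (𝓝 (f η))) : Tendsto F l (𝓝 f) := by
  rw [Metric.tendsto_nhds]
  intro r hr
  have h' : ∀ᶠ i in l, ∀ η ∈ Set.range (trunc n), dist (F i η) (f η) < r :=
    (finite_range_trunc n).eventually_all.2 fun η _ => Metric.tendsto_nhds.1 (h η) r hr
  filter_upwards [h'] with i hi
  refine (ContinuousMap.dist_lt_iff hr).2 fun η => ?_
  rw [← apply_trunc_of_mem_D (hF i) η, ← apply_trunc_of_mem_D hf η]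
  exact hi _ ⟨η, rfl⟩

/-- The generator on `D n`. -/
noncomputable def genFun (n : ℕ) (f : C(NatPartition, ℝ)) : C(NatPartition, ℝ) :=
  ofAgreeOn n (fun η => gen n η f) fun η π h => by rw [h.gen_eq]

theorem tendsto_transOp_slope {n : ℕ} {f : C(NatPartition, ℝ)} (hf : f ∈ D n) :
    Tendsto (fun t : ℝ≥0 => (t : ℝ)⁻¹ • (transOp t f - f)) (𝓝[>] 0) (𝓝 (genFun n f)) := by
  refine tendsto_of_mem_D (n := n)
    (fun t => (D n).smul_mem _ ((D n).sub_mem (transOp_mem_D t hf) hf)) (ofAgreeOn_mem _)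
    fun η => ?_
  have h0 := (hasDerivAt_iff_tendsto_slope_zero.1 (hasDerivAt_semi n η f))
  have hc : Tendsto (fun t : ℝ≥0 => (t : ℝ)) (𝓝[>] 0) (𝓝[≠] 0) := by
    refine tendsto_nhdsWithin_iff.2 ⟨?_, ?_⟩
    · exact (NNReal.continuous_coe.tendsto' 0 0 rfl).mono_left nhdsWithin_le_nhds
    · filter_upwards [self_mem_nhdsWithin] with t ht
      exact NNReal.coe_ne_zero.2 (ne_of_gt ht)
  refine (h0.comp hc).congr fun t => ?_
  simp only [Function.comp_apply, zero_add, ContinuousMap.smul_apply, ContinuousMap.sub_apply,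
    transOp_eq_semiOp t hf, semiOp_apply, semi_at_zero, apply_trunc_of_mem_D hf]

theorem tendsto_transOp_zero (f : C(NatPartition, ℝ)) :
    Tendsto (fun t => transOp t f) (𝓝 0) (𝓝 f) := by
  rw [Metric.tendsto_nhds]
  intro r hr
  obtain ⟨n, -, g, hg, h⟩ := exists_mem_D_norm_sub_lt f (r := r / 3) (by positivity)
  have hlim : Tendsto (fun t => transOp t g) (𝓝 0) (𝓝 g) := by
    refine tendsto_of_mem_D (fun t => transOp_mem_D t hg) hg fun η => ?_
    have h1 := (hasDerivAt_semi n η g).continuousAt.tendsto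
    rw [semi_at_zero, apply_trunc_of_mem_D hg] at h1
    refine (h1.comp (NNReal.continuous_coe.tendsto' 0 0 rfl)).congr fun t => ?_
    rw [transOp_eq_semiOp t hg]
    rfl
  filter_upwards [Metric.tendsto_nhds.1 hlim (r / 3) (by positivity)] with t ht
  have h1 := norm_transOp_le t (f - g)
  rw [map_sub] at h1
  rw [dist_eq_norm] at ht ⊢
  have h2 : transOp t f - f = (transOp t f - transOp t g) + (transOp t g - g) - (f - g) := by abel
  have h3 := norm_sub_le ((transOp t f - transOp t g) + (transOp t g - g)) (f - g)
  have h4 := norm_add_le (transOp t f - transOp t g) (transOp t g - g)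
  rw [h2]
  linarith

end NatPartition

namespace NatPartition

/-! ### Measurability -/

theorem isClopen_rel (i j : ℕ) : IsClopen {π : NatPartition | π.rel i j} := by
  classical
  have hc : Continuous fun π : NatPartition => if π.rel i j then (1 : ℝ) else 0 :=
    continuous_of_agreeOn (n := i + j + 1) fun η π h => by
      simp only [h i (by omega) j (by omega)]
  have h1 : {π : NatPartition | π.rel i j} =
      (fun π : NatPartition => if π.rel i j then (1 : ℝ) else 0) ⁻¹' {1} := by
    ext π; by_cases h : π.rel i j <;> simp [h]
  have h2 : {π : NatPartition | π.rel i j} =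
      (fun π : NatPartition => if π.rel i j then (1 : ℝ) else 0) ⁻¹' {0}ᶜ := by
    ext π; by_cases h : π.rel i j <;> simp [h]
  constructor
  · rw [h1]; exact isClosed_singleton.preimage hc
  · rw [h2]; exact isOpen_compl_singleton.preimage hc

/-- The relations `i ∼ j` generate the Borel sets, since they define a continuous injection into
a countable power of `ℝ`. -/
theorem measurable_of_rel {Ω : Type*} [MeasurableSpace Ω] {X : Ω → NatPartition}
    (h : ∀ i j, MeasurableSet {ω | (X ω).rel i j}) : Measurable X := by
  classical
  let φ : NatPartition → ℕ → ℕ → ℝ := fun π i j => if π.rel i j then 1 else 0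
  have hφ : Continuous φ := continuous_pi fun i => continuous_pi fun j =>
    continuous_of_agreeOn (n := i + j + 1) fun η π h => by
      simp only [φ, h i (by omega) j (by omega)]
  have hinj : Function.Injective φ := by
    intro η π h
    ext i j
    have := congr_fun (congr_fun h i) j
    by_cases h1 : η.rel i j <;> by_cases h2 : π.rel i j <;> simp_all [φ]
  refine (hφ.measurableEmbedding hinj).measurable_comp_iff.1 ?_
  refine measurable_pi_lambda _ fun i => measurable_pi_lambda _ fun j => ?_
  exact Measurable.ite (h i j) measurable_const measurable_const

theorem measurableSet_rel {Ω : Type*} [MeasurableSpace Ω] {X : Ω → NatPartition}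
    (h : Measurable X) (i j : ℕ) : MeasurableSet {ω | (X ω).rel i j} :=
  h (isClopen_rel i j).1.measurableSet

theorem measurable_attach (n j : ℕ) : Measurable fun σ : NatPartition => attach σ n j :=
  measurable_of_rel fun _ _ => (isClopen_rel _ _).1.measurableSet

theorem measurable_of_agreeOn {n : ℕ} {f : NatPartition → ℝ}
    (hf : ∀ η π, AgreeOn n η π → f η = f π) : Measurable f :=
  (continuous_of_agreeOn hf).measurable

theorem measurable_semi (t : ℝ) (n : ℕ) (f : NatPartition → ℝ) :
    Measurable fun η => semi t n η f :=
  measurable_of_agreeOn (n := n) fun η π h => by rw [h.semi_eq]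

end NatPartition

/-! ### Independence -/

/-- Exchanging the two middle factors of a product of four measures. -/
theorem measurePreserving_prod_prod_comm {A B C D : Type*} [MeasurableSpace A] [MeasurableSpace B]
    [MeasurableSpace C] [MeasurableSpace D] (a : Measure A) (b : Measure B) (c : Measure C)
    (d : Measure D) [IsProbabilityMeasure a] [IsProbabilityMeasure b] [IsProbabilityMeasure c]
    [IsProbabilityMeasure d] :
    MeasurePreserving (fun x : (A × B) × (C × D) => ((x.1.1, x.2.1), (x.1.2, x.2.2)))
      ((a.prod b).prod (c.prod d)) ((a.prod c).prod (b.prod d)) := by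
  have h1 := measurePreserving_prodAssoc a b (c.prod d)
  have h2 := (MeasurePreserving.id a).prod ((measurePreserving_prodAssoc b c d).symm)
  have h3 := (MeasurePreserving.id a).prod
    ((Measure.measurePreserving_swap (μ := b) (ν := c)).prod (MeasurePreserving.id d))
  have h4 := (MeasurePreserving.id a).prod (measurePreserving_prodAssoc c b d)
  have h5 := (measurePreserving_prodAssoc a c (b.prod d)).symm
  exact h5.comp (h4.comp (h3.comp (h2.comp h1)))

theorem indepFun_prodMk_prodMk {Ω A B C D : Type*} [MeasurableSpace Ω] {μ : Measure Ω}
    [IsProbabilityMeasure μ] [MeasurableSpace A] [MeasurableSpace B] [MeasurableSpace C]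
    [MeasurableSpace D] {X : Ω → A} {Y : Ω → B} {Z : Ω → C} {W : Ω → D} (hX : Measurable X)
    (hY : Measurable Y) (hZ : Measurable Z) (hW : Measurable W) (hXY : IndepFun X Y μ)
    (hZW : IndepFun Z W μ)
    (h : IndepFun (fun ω => (X ω, Y ω)) (fun ω => (Z ω, W ω)) μ) :
    IndepFun (fun ω => (X ω, Z ω)) (fun ω => (Y ω, W ω)) μ := by
  have hXZ : IndepFun X Z μ := h.comp measurable_fst measurable_fst
  have hYW : IndepFun Y W μ := h.comp measurable_snd measurable_snd
  rw [indepFun_iff_map_prod_eq_prod_map_map (by fun_prop) (by fun_prop)] at hXY hZW h hXZ hYW ⊢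
  have := Measure.isProbabilityMeasure_map (μ := μ) hX.aemeasurable
  have := Measure.isProbabilityMeasure_map (μ := μ) hY.aemeasurable
  have := Measure.isProbabilityMeasure_map (μ := μ) hZ.aemeasurable
  have := Measure.isProbabilityMeasure_map (μ := μ) hW.aemeasurable
  have key := (measurePreserving_prod_prod_comm (μ.map X) (μ.map Y) (μ.map Z) (μ.map W)).map_eq
  rw [← hXY, ← hZW, ← h, Measure.map_map (by fun_prop) (by fun_prop)] at key
  rw [hXZ, hYW]
  exact key

theorem integral_uniformLaw (n : ℕ) (g : Fin (n + 1) → ℝ) :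
    ∫ j, g j ∂NatPartition.uniformLaw n = ((n + 1 : ℕ) : ℝ)⁻¹ * ∑ j, g j := by
  rw [NatPartition.uniformLaw, PMF.integral_eq_sum, Finset.mul_sum]
  refine Finset.sum_congr rfl fun j _ => ?_
  rw [PMF.uniformOfFintype_apply, Fintype.card_fin, ENNReal.toReal_inv, ENNReal.toReal_natCast,
    smul_eq_mul]

theorem expMeasure_one_real_Ioi {s : ℝ} (hs : 0 ≤ s) :
    (expMeasure 1).real (Set.Ioi s) = Real.exp (-s) := by
  have := isProbabilityMeasure_expMeasure one_pos
  have h := cdf_expMeasure_eq one_pos s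
  rw [cdf_eq_real, if_pos hs, one_mul] at h
  rw [← Set.compl_Iic, probReal_compl_eq_one_sub measurableSet_Iic, h]
  ring

namespace IsTreeDestruction

variable {Ω : Type*} [MeasurableSpace Ω] {μ : Measure Ω}
  {u : (i : ℕ) → Ω → Fin (i + 1)} {e : ℕ → Ω → ℝ}

theorem indepFun_finset [IsProbabilityMeasure μ] (h : IsTreeDestruction μ u e) (n : ℕ) :
    IndepFun (fun ω => ((fun i : Finset.range n => u i ω), (fun i : Finset.range n => e i ω)))
      (fun ω => (u n ω, e n ω)) μ := by
  have hu := h.measurable_parent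
  have he := h.measurable_time
  have hd : Disjoint (Finset.range n) {n} := by simp
  have h1 := (h.indep_parent.indepFun_finset (Finset.range n) {n} hd hu).comp measurable_id
    (measurable_pi_apply (⟨n, Finset.mem_singleton_self n⟩ : ({n} : Finset ℕ)))
  have h2 := (h.indep_time.indepFun_finset (Finset.range n) {n} hd he).comp measurable_id
    (measurable_pi_apply (⟨n, Finset.mem_singleton_self n⟩ : ({n} : Finset ℕ)))
  refine indepFun_prodMk_prodMk (by fun_prop) (hu n) (by fun_prop) (he n) h1 h2 ?_
  exact h.indep.comp
    (φ := fun v : (i : ℕ) → Fin (i + 1) => ((fun i : Finset.range n => v i), v n))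
    (ψ := fun a : ℕ → ℝ => ((fun i : Finset.range n => a i), a n))
    (by fun_prop) (by fun_prop)

theorem indepFun_parent_time (h : IsTreeDestruction μ u e) (n : ℕ) : IndepFun (u n) (e n) μ :=
  h.indep.comp (φ := fun v : (i : ℕ) → Fin (i + 1) => v n) (ψ := fun a : ℕ → ℝ => a n)
    (by fun_prop) (by fun_prop)

/-- The last edge can be integrated out of a function of it and of a variable `X` that is
independent of it. -/
theorem integral_last [IsProbabilityMeasure μ] {E : Type*} [MeasurableSpace E]
    (h : IsTreeDestruction μ u e) {n : ℕ} {X : Ω → E} (hX : Measurable X)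
    (hXind : IndepFun X (fun ω => (u n ω, e n ω)) μ)
    {F : E → Fin (n + 1) → ℝ → ℝ}
    (hF : Measurable fun p : E × Fin (n + 1) × ℝ => F p.1 p.2.1 p.2.2) {C : ℝ}
    (hC : ∀ x j a, |F x j a| ≤ C) :
    ∫ ω, F (X ω) (u n ω) (e n ω) ∂μ =
      ((n + 1 : ℕ) : ℝ)⁻¹ * ∑ j, ∫ a, ∫ ω, F (X ω) j a ∂μ ∂(expMeasure 1) := by
  have hu := h.measurable_parent n
  have he := h.measurable_time n
  have := isProbabilityMeasure_expMeasure one_pos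
  have := Measure.isProbabilityMeasure_map (μ := μ) hX.aemeasurable
  have hlaw : μ.map (fun ω => (X ω, (u n ω, e n ω))) =
      (μ.map X).prod ((NatPartition.uniformLaw n).prod (expMeasure 1)) := by
    rw [(indepFun_iff_map_prod_eq_prod_map_map hX.aemeasurable (by fun_prop)).1 hXind,
      (indepFun_iff_map_prod_eq_prod_map_map hu.aemeasurable he.aemeasurable).1
        (h.indepFun_parent_time n), h.law_parent, h.law_time]
  have hint : Integrable (fun p : E × Fin (n + 1) × ℝ => F p.1 p.2.1 p.2.2)
      ((μ.map X).prod ((NatPartition.uniformLaw n).prod (expMeasure 1))) :=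
    Integrable.of_bound hF.aestronglyMeasurable C (ae_of_all _ fun p => hC _ _ _)
  have h1 : ∫ ω, F (X ω) (u n ω) (e n ω) ∂μ = ∫ p, F p.1 p.2.1 p.2.2
      ∂(μ.map fun ω => (X ω, (u n ω, e n ω))) :=
    (integral_map (hX.prodMk (hu.prodMk he)).aemeasurable hF.aestronglyMeasurable).symm
  rw [h1, hlaw, integral_prod_symm _ hint, integral_prod _ hint.integral_prod_right,
    integral_uniformLaw]
  congr 1
  refine Finset.sum_congr rfl fun j _ => integral_congr_ae (ae_of_all _ fun a => ?_)
  exact integral_map hX.aemeasurable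
    (hF.comp (measurable_id.prodMk measurable_const)).aestronglyMeasurable

end IsTreeDestruction

namespace NatPartition

/-! ### The destruction of finite recursive trees -/

/-- The partition of the vertices `0, …, n` into the components of the forest that is left at time
`t`, all larger vertices being singletons. The vertex `n + 1` is added in the `n`-th step. -/
noncomputable def part (p : (i : ℕ) → Fin (i + 1)) (a : ℕ → ℝ) (t : ℝ≥0) : ℕ → NatPartition
  | 0 => discrete
  | n + 1 => if (t : ℝ) < a n then attach (part p a t n) (n + 1) (p n) else part p a t n

variable {p : (i : ℕ) → Fin (i + 1)} {a : ℕ → ℝ} {t : ℝ≥0}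

theorem part_succ_of_lt {n : ℕ} (h : (t : ℝ) < a n) :
    part p a t (n + 1) = attach (part p a t n) (n + 1) (p n) := if_pos h

theorem part_succ_of_not_lt {n : ℕ} (h : ¬ (t : ℝ) < a n) :
    part p a t (n + 1) = part p a t n := if_neg h

theorem isolatedFrom_part (n : ℕ) : IsolatedFrom (n + 1) (part p a t n) := by
  induction n with
  | zero => exact isolatedFrom_discrete _
  | succ n ih =>
    by_cases h : (t : ℝ) < a n
    · rw [part_succ_of_lt h]
      exact ih.attach (p n).2
    · rw [part_succ_of_not_lt h]
      exact ih.mono (by omega)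

theorem part_agreeOn {m n : ℕ} (hmn : m ≤ n) : AgreeOn (m + 1) (part p a t n) (part p a t m) := by
  induction n, hmn using Nat.le_induction with
  | base => exact AgreeOn.refl _ _
  | succ n hmn ih =>
    by_cases h : (t : ℝ) < a n
    · rw [part_succ_of_lt h]
      exact ((attach_agreeOn _ _ _).mono (by omega)).trans ih
    · rwa [part_succ_of_not_lt h]

theorem part_anti {s : ℝ≥0} (hst : s ≤ t) (n : ℕ) {x y : ℕ} (h : (part p a t n).rel x y) :
    (part p a s n).rel x y := by
  induction n generalizing x y with
  | zero => exact h
  | succ n ih =>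
    by_cases ht : (t : ℝ) < a n
    · rw [part_succ_of_lt ht] at h
      rw [part_succ_of_lt ((NNReal.coe_le_coe.2 hst).trans_lt ht)]
      exact ih h
    · rw [part_succ_of_not_lt ht] at h
      by_cases hs : (s : ℝ) < a n
      · rw [part_succ_of_lt hs]
        rcases eq_or_ne x y with rfl | hne
        · exact (attach _ _ _).iseqv.refl x
        · have hx : x ≠ n + 1 := fun hx => hne (isolatedFrom_part n x y hx.ge h)
          have hy : y ≠ n + 1 := fun hy =>
            hne (isolatedFrom_part n y x hy.ge ((part p a t n).iseqv.symm h)).symm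
          simp only [attach, if_neg hx, if_neg hy]
          exact ih h
      · rw [part_succ_of_not_lt hs]
        exact ih h

theorem part_congr {p' : (i : ℕ) → Fin (i + 1)} {a' : ℕ → ℝ} {n : ℕ}
    (hp : ∀ i < n, p i = p' i) (ha : ∀ i < n, a i = a' i) : part p a t n = part p' a' t n := by
  induction n with
  | zero => rfl
  | succ n ih =>
    simp only [part]
    rw [ih (fun i hi => hp i (hi.trans n.lt_succ_self))
      (fun i hi => ha i (hi.trans n.lt_succ_self)),
      hp n n.lt_succ_self, ha n n.lt_succ_self]

theorem eventually_part_rel_of_adj {x y : ℕ} (h : (remainingForest p a t).Adj x y) :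
    ∀ᶠ n in atTop, (part p a t n).rel x y := by
  have key : ∀ i, (t : ℝ) < a i → ∀ᶠ n in atTop, (part p a t n).rel (i + 1) (p i) := by
    intro i hi
    filter_upwards [eventually_ge_atTop (i + 1)] with n hn
    have hlt := (p i).2
    refine (part_agreeOn hn (i + 1) (by omega) (p i) (by omega)).2 ?_
    rw [part_succ_of_lt hi]
    simp only [attach, if_pos]
    rw [if_neg (by omega)]
    exact (part p a t i).iseqv.refl _
  obtain ⟨-, ⟨i, rfl, rfl, hi⟩ | ⟨i, rfl, rfl, hi⟩⟩ := (SimpleGraph.fromRel_adj _ _ _).1 h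
  · exact key i hi
  · exact (key i hi).mono fun n hn => (part p a t n).iseqv.symm hn

theorem eventually_part_rel_of_reachable {x y : ℕ} (h : (remainingForest p a t).Reachable x y) :
    ∀ᶠ n in atTop, (part p a t n).rel x y := by
  rw [SimpleGraph.reachable_iff_reflTransGen] at h
  induction h with
  | refl => exact Eventually.of_forall fun n => (part p a t n).iseqv.refl x
  | tail _ hadj ih =>
    filter_upwards [ih, eventually_part_rel_of_adj hadj] with n h1 h2
    exact (part p a t n).iseqv.trans h1 h2

theorem reachable_of_part_rel {n x y : ℕ} (h : (part p a t n).rel x y) :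
    (remainingForest p a t).Reachable x y := by
  induction n generalizing x y with
  | zero => obtain rfl : x = y := h; exact SimpleGraph.Reachable.refl _
  | succ n ih =>
    by_cases ht : (t : ℝ) < a n
    · rw [part_succ_of_lt ht] at h
      have key : ∀ z, (remainingForest p a t).Reachable (if z = n + 1 then ((p n : Fin (n + 1)) : ℕ)
          else z) z := by
        intro z
        split_ifs with hz
        · subst hz
          refine (SimpleGraph.Adj.reachable ?_).symm
          have hlt := (p n).2
          exact (SimpleGraph.fromRel_adj _ _ _).2 ⟨by omega, Or.inl ⟨n, rfl, rfl, ht⟩⟩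
        · exact SimpleGraph.Reachable.refl _
      exact (key x).symm.trans ((ih h).trans (key y))
    · rw [part_succ_of_not_lt ht] at h
      exact ih h

/-- The components of the infinite forest, restricted to the vertices `0, …, n`, are those of the
forest on these vertices: a path between two of them need not use larger vertices. -/
theorem part_rel_iff_reachable {n x y : ℕ} (hx : x < n + 1) (hy : y < n + 1) :
    (remainingForest p a t).Reachable x y ↔ (part p a t n).rel x y := by
  refine ⟨fun h => ?_, reachable_of_part_rel⟩
  obtain ⟨m, hm, hnm⟩ := ((eventually_part_rel_of_reachable h).and (eventually_ge_atTop n)).exists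
  exact (part_agreeOn hnm x hx y hy).1 hm

/-! ### Conditioning on the last edge -/

/-- The path of partitions after adding the vertex `n + 1` with parent `j` and removal time `b`. -/
noncomputable def step (n : ℕ) (x : ℝ≥0 → NatPartition) (j : Fin (n + 1)) (b : ℝ) :
    ℝ≥0 → NatPartition :=
  fun r => if (r : ℝ) < b then attach (x r) (n + 1) j else x r

theorem measurable_attach_prod (n k : ℕ) :
    Measurable fun q : NatPartition × Fin k => attach q.1 n q.2 :=
  measurable_from_prod_countable_left fun j => measurable_attach n j

theorem measurable_step (n : ℕ) :
    Measurable fun q : (ℝ≥0 → NatPartition) × Fin (n + 1) × ℝ => step n q.1 q.2.1 q.2.2 := by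
  refine measurable_pi_lambda _ fun r => Measurable.ite ?_ ?_ ?_
  · exact measurableSet_lt measurable_const (by fun_prop)
  · have hm : Measurable fun q : (ℝ≥0 → NatPartition) × Fin (n + 1) × ℝ => (q.1 r, q.2.1) :=
      ((measurable_pi_apply r).comp measurable_fst).prodMk (measurable_fst.comp measurable_snd)
    exact (measurable_attach_prod (n + 1) (n + 1)).comp hm
  · exact (measurable_pi_apply r).comp measurable_fst

theorem measurable_part (n : ℕ) :
    Measurable fun (q : ((i : ℕ) → Fin (i + 1)) × (ℕ → ℝ)) (r : ℝ≥0) => part q.1 q.2 r n := by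
  induction n with
  | zero =>
    exact (measurable_const : Measurable fun (_ : ((i : ℕ) → Fin (i + 1)) × (ℕ → ℝ)) (_ : ℝ≥0) =>
      discrete)
  | succ n ih =>
    exact (measurable_step n).comp (ih.prodMk (Measurable.prodMk
      ((measurable_pi_apply n).comp measurable_fst) ((measurable_pi_apply n).comp measurable_snd)))

/-- Averaging over a class of an equivalence relation first does not change a sum that is weighted
by a function on the classes. -/
theorem sum_mul_class_mean (σ : NatPartition) (n : ℕ) (A d : ℕ → ℝ)
    (hA : ∀ j k, σ.rel j k → A j = A k) :
    ∑ j ∈ Finset.range n, A j * ((((attach σ n j).earlier n).card : ℝ)⁻¹ *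
      ∑ k ∈ (attach σ n j).earlier n, d k) = ∑ j ∈ Finset.range n, A j * d j := by
  have hE : ∀ j k, σ.rel j k → (attach σ n j).earlier n = (attach σ n k).earlier n :=
    fun j k h => by rw [attach_eq_of_rel h]
  simp_rw [Finset.mul_sum]
  rw [Finset.sum_comm' (t' := Finset.range n) (s' := fun k => (attach σ n k).earlier n)]
  · refine Finset.sum_congr rfl fun k hk => ?_
    have hk' : k ∈ (attach σ n k).earlier n :=
      mem_earlier_attach.2 ⟨Finset.mem_range.1 hk, σ.iseqv.refl k⟩
    have hc : (((attach σ n k).earlier n).card : ℝ) ≠ 0 := by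
      exact_mod_cast (Finset.card_pos.2 ⟨k, hk'⟩).ne'
    rw [Finset.sum_congr rfl fun j hj => by
      rw [hA j k (mem_earlier_attach.1 hj).2, hE j k (mem_earlier_attach.1 hj).2],
      Finset.sum_const, nsmul_eq_mul]
    field_simp
  · intro j k
    rw [mem_earlier_attach, mem_earlier_attach, Finset.mem_range, Finset.mem_range]
    exact ⟨fun ⟨h1, h2, h3⟩ => ⟨⟨h1, σ.iseqv.symm h3⟩, h2⟩,
      fun ⟨⟨h1, h2⟩, h3⟩ => ⟨h1, h3, σ.iseqv.symm h2⟩⟩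

theorem semi_attach (t : ℝ) {n j : ℕ} (hj : j < n) (σ : NatPartition) (f : NatPartition → ℝ) :
    semi t (n + 1) (attach σ n j) f = (1 - Real.exp (-t)) * semi t n σ f +
      Real.exp (-t) * ((((attach σ n j).earlier n).card : ℝ)⁻¹ *
        ∑ k ∈ (attach σ n j).earlier n, semi t n σ fun τ => f (attach τ n k)) := by
  have hne : ((attach σ n j).earlier n).Nonempty :=
    ⟨j, mem_earlier_attach.2 ⟨hj, σ.iseqv.refl j⟩⟩
  have havg : avg (attach σ n j) n f = (((attach σ n j).earlier n).card : ℝ)⁻¹ •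
      ∑ k ∈ (attach σ n j).earlier n, fun τ => f (attach τ n k) := by
    ext τ
    simp [avg_apply_of_nonempty hne]
  rw [semi_succ_apply, (attach_agreeOn σ n j).semi_eq, havg, map_smul, map_sum, smul_eq_mul]

theorem semi_of_isolated (t : ℝ) {n : ℕ} {σ : NatPartition} (h : IsolatedFrom n σ)
    (f : NatPartition → ℝ) : semi t (n + 1) σ f = semi t n σ f := by
  rw [semi_succ_apply, avg_of_earlier_eq_empty h.earlier_eq]
  ring

end NatPartition

theorem integral_expMeasure_add_indicator {g : ℝ → ℝ} (hg : Integrable g (expMeasure 1))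
    {x y : ℝ} (hx : 0 ≤ x) (hy : 0 ≤ y) (K L : ℝ) :
    ∫ b, (g b + ((Set.Ioi x).indicator (fun _ => K) b + (Set.Ioi y).indicator (fun _ => L) b))
        ∂(expMeasure 1) =
      ∫ b, g b ∂(expMeasure 1) + (Real.exp (-x) * K + Real.exp (-y) * L) := by
  have := isProbabilityMeasure_expMeasure one_pos
  have hi : ∀ x K : ℝ, Integrable (fun b => (Set.Ioi x).indicator (fun _ => K) b) (expMeasure 1) :=
    fun x K => (integrable_const K).indicator measurableSet_Ioi
  rw [integral_add hg (f := g) (g := fun b => (Set.Ioi x).indicator (fun _ => K) b +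
      (Set.Ioi y).indicator (fun _ => L) b) ((hi x K).add (hi y L)),
    integral_add (hi x K) (hi y L), integral_indicator_const _ measurableSet_Ioi,
    integral_indicator_const _ measurableSet_Ioi, expMeasure_one_real_Ioi hx,
    expMeasure_one_real_Ioi hy, smul_eq_mul, smul_eq_mul]

namespace IsTreeDestruction

open NatPartition

variable {Ω : Type*} [MeasurableSpace Ω] {μ : Measure Ω}
  {u : (i : ℕ) → Ω → Fin (i + 1)} {e : ℕ → Ω → ℝ}

theorem measurable_path (h : IsTreeDestruction μ u e) (n : ℕ) :
    Measurable fun ω (r : ℝ≥0) => part (fun i => u i ω) (fun i => e i ω) r n :=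
  (measurable_part n).comp ((measurable_pi_lambda _ h.measurable_parent).prodMk
    (measurable_pi_lambda _ h.measurable_time))

theorem measurable_part_apply (h : IsTreeDestruction μ u e) (n : ℕ) (r : ℝ≥0) :
    Measurable fun ω => part (fun i => u i ω) (fun i => e i ω) r n :=
  (measurable_pi_apply r).comp (h.measurable_path n)

theorem indepFun_path [IsProbabilityMeasure μ] (h : IsTreeDestruction μ u e) (n : ℕ) :
    IndepFun (fun ω (r : ℝ≥0) => part (fun i => u i ω) (fun i => e i ω) r n)
      (fun ω => (u n ω, e n ω)) μ := by
  let ext : ((i : Finset.range n) → Fin ((i : ℕ) + 1)) × (Finset.range n → ℝ) →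
      ((i : ℕ) → Fin (i + 1)) × (ℕ → ℝ) := fun q =>
    (fun i => if hi : i ∈ Finset.range n then q.1 ⟨i, hi⟩ else 0,
      fun i => if hi : i ∈ Finset.range n then q.2 ⟨i, hi⟩ else 0)
  have hext : Measurable ext := by
    refine Measurable.prodMk (measurable_pi_lambda _ fun i => ?_)
      (measurable_pi_lambda _ fun i => ?_)
    · by_cases hi : i ∈ Finset.range n
      · simp only [dif_pos hi]
        exact (measurable_pi_apply _).comp measurable_fst
      · simp only [dif_neg hi]
        exact measurable_const
    · by_cases hi : i ∈ Finset.range n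
      · simp only [dif_pos hi]
        exact (measurable_pi_apply _).comp measurable_snd
      · simp only [dif_neg hi]
        exact measurable_const
  have key := (h.indepFun_finset n).comp ((measurable_part n).comp hext) measurable_id
  convert key using 1
  · ext1 ω
    ext1 r
    exact part_congr (fun i hi => by simp [ext, hi]) (fun i hi => by simp [ext, hi])
  · rfl

/-- Integrating out the last edge in a bounded functional of the path of partitions. -/
theorem integral_path_succ [IsProbabilityMeasure μ] (h : IsTreeDestruction μ u e) (n : ℕ)
    {F : (ℝ≥0 → NatPartition) → ℝ} (hF : Measurable F) {C : ℝ} (hC : ∀ x, |F x| ≤ C) :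
    ∫ ω, F (fun r => part (fun i => u i ω) (fun i => e i ω) r (n + 1)) ∂μ =
      ((n + 1 : ℕ) : ℝ)⁻¹ * ∑ j, ∫ b, ∫ ω, F (step n
        (fun r => part (fun i => u i ω) (fun i => e i ω) r n) j b) ∂μ ∂(expMeasure 1) :=
  h.integral_last (h.measurable_path n) (h.indepFun_path n)
    (F := fun x j b => F (step n x j b)) (hF.comp (measurable_step n)) fun _ _ _ => hC _

theorem integrable_path_step [IsProbabilityMeasure μ] (h : IsTreeDestruction μ u e) (n : ℕ)
    {F : (ℝ≥0 → NatPartition) → ℝ} (hF : Measurable F) {C : ℝ} (hC : ∀ x, |F x| ≤ C)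
    (j : Fin (n + 1)) :
    Integrable (fun b => ∫ ω, F (step n
      (fun r => part (fun i => u i ω) (fun i => e i ω) r n) j b) ∂μ) (expMeasure 1) := by
  have := isProbabilityMeasure_expMeasure one_pos
  have hm : Measurable fun q : Ω × ℝ =>
      F (step n (fun r => part (fun i => u i q.1) (fun i => e i q.1) r n) j q.2) :=
    hF.comp ((measurable_step n).comp (((h.measurable_path n).comp measurable_fst).prodMk
      (measurable_const.prodMk measurable_snd)))
  have hint : Integrable (fun q : Ω × ℝ =>
      F (step n (fun r => part (fun i => u i q.1) (fun i => e i q.1) r n) j q.2))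
      (μ.prod (expMeasure 1)) :=
    Integrable.of_bound hm.aestronglyMeasurable C (ae_of_all _ fun p => hC _)
  exact hint.integral_prod_right

/-- The Markov property of the destruction of the tree on the vertices `0, …, n`. The proof is by
induction on `n`, conditioning on the parent `j` and the removal time `b` of the last vertex. If
`b ≤ s`, the last vertex is isolated at time `s`. If `b > s`, then the past up to time `s` depends
on `j` only through the block of `j` at time `s`, so that `j` may be replaced by a uniform element
of that block, and `b - s` is again exponential. -/
theorem integral_part_mul [IsProbabilityMeasure μ] (h : IsTreeDestruction μ u e) (s t : ℝ≥0)
    (n : ℕ) {Φ : (ℝ≥0 → NatPartition) → ℝ} (hΦ : Measurable Φ) {C : ℝ} (hC : ∀ x, |Φ x| ≤ C)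
    (hloc : ∀ x y, (∀ r ≤ s, x r = y r) → Φ x = Φ y)
    {f : NatPartition → ℝ} (hf : Measurable f) {C' : ℝ} (hC' : ∀ σ, |f σ| ≤ C') :
    ∫ ω, Φ (fun r => part (fun i => u i ω) (fun i => e i ω) r n) *
        f (part (fun i => u i ω) (fun i => e i ω) (s + t) n) ∂μ =
      ∫ ω, Φ (fun r => part (fun i => u i ω) (fun i => e i ω) r n) *
        semi t (n + 1) (part (fun i => u i ω) (fun i => e i ω) s n) f ∂μ := by
  induction n generalizing Φ f with
  | zero =>
    simp only [part, zero_add]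
    rw [semi_of_isolated _ (isolatedFrom_discrete 0), semi_zero_apply]
  | succ n ih =>
    have := isProbabilityMeasure_expMeasure one_pos
    have hC0 : 0 ≤ C := (abs_nonneg _).trans (hC fun _ => discrete)
    set W : Ω → ℝ≥0 → NatPartition := fun ω r => part (fun i => u i ω) (fun i => e i ω) r n with hW
    have hWm : Measurable W := h.measurable_path n
    have hbd : ∀ x y : ℝ, |x| ≤ C → |y| ≤ C' → |x * y| ≤ C * C' := fun x y hx hy => by
      rw [abs_mul]; exact mul_le_mul hx hy (abs_nonneg _) hC0
    -- the two functionals of the path that are compared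
    set F : (ℝ≥0 → NatPartition) → ℝ := fun x => Φ x * f (x (s + t)) with hFdef
    set H : (ℝ≥0 → NatPartition) → ℝ := fun x => Φ x * semi t (n + 2) (x s) f with hHdef
    have hF : Measurable F := hΦ.mul (hf.comp (measurable_pi_apply _))
    have hH : Measurable H := hΦ.mul ((measurable_semi t (n + 2) f).comp (measurable_pi_apply _))
    have hFC : ∀ x, |F x| ≤ C * C' := fun x => hbd _ _ (hC x) (hC' _)
    have hHC : ∀ x, |H x| ≤ C * C' := fun x => hbd _ _ (hC x) (abs_semi_le t.2 _ _ hC')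
    have e1 := h.integral_path_succ n hF hFC
    have e2 := h.integral_path_succ n hH hHC
    refine e1.trans (Eq.trans ?_ e2.symm)
    congr 1
    -- the past when the last vertex has parent `j` and is still attached at time `s`
    let A : ℕ → Ω → ℝ := fun j ω => Φ fun r => attach (W ω r) (n + 1) j
    let c : Ω → ℝ := fun ω => semi t (n + 1) (W ω s) f
    let d : ℕ → Ω → ℝ := fun j ω => semi t (n + 1) (W ω s) fun τ => f (attach τ (n + 1) j)
    let E : ℕ → Ω → Finset ℕ := fun j ω => (attach (W ω s) (n + 1) j).earlier (n + 1)
    let R : ℕ → Ω → ℝ := fun j ω => ((E j ω).card : ℝ)⁻¹ * ∑ k ∈ E j ω, d k ω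
    have hAm : ∀ j, Measurable (A j) := fun j => hΦ.comp (measurable_pi_lambda _ fun r =>
      (measurable_attach (n + 1) j).comp ((measurable_pi_apply r).comp hWm))
    have hcm : Measurable c := (measurable_semi t (n + 1) f).comp ((measurable_pi_apply s).comp hWm)
    have hdm : ∀ j, Measurable (d j) := fun j =>
      (measurable_semi t (n + 1) _).comp ((measurable_pi_apply s).comp hWm)
    have hint : ∀ {g : Ω → ℝ}, Measurable g → (∀ ω, |g ω| ≤ C * C') → Integrable g μ :=
      fun hg hb => Integrable.of_bound hg.aestronglyMeasurable (C * C') (ae_of_all _ hb)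
    have hAc : ∀ j, Integrable (fun ω => A j ω * c ω) μ := fun j =>
      hint ((hAm j).mul hcm) fun ω => hbd _ _ (hC _) (abs_semi_le t.2 _ _ hC')
    have hAd : ∀ j, Integrable (fun ω => A j ω * d j ω) μ := fun j =>
      hint ((hAm j).mul (hdm j)) fun ω => hbd _ _ (hC _) (abs_semi_le t.2 _ _ fun _ => hC' _)
    have hsemi : ∀ j < n + 1, ∀ ω, semi t (n + 2) (attach (W ω s) (n + 1) j) f =
        (1 - Real.exp (-t)) * c ω + Real.exp (-t) * R j ω := fun j hj ω =>
      semi_attach t hj (W ω s) f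
    have hAR : ∀ j < n + 1, Integrable (fun ω => A j ω * R j ω) μ := by
      intro j hj
      have h1 : Integrable (fun ω => A j ω * semi t (n + 2) (attach (W ω s) (n + 1) j) f) μ :=
        hint ((hAm j).mul ((measurable_semi t (n + 2) f).comp ((measurable_attach (n + 1) j).comp
          ((measurable_pi_apply s).comp hWm))))
          fun ω => hbd _ _ (hC _) (abs_semi_le t.2 _ _ hC')
      refine ((h1.sub ((hAc j).const_mul (1 - Real.exp (-t)))).const_mul
        (Real.exp (-t))⁻¹).congr (ae_of_all _ fun ω => ?_)
      simp only [Pi.sub_apply, hsemi j hj ω]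
      field_simp
      ring
    -- the identity behind the induction step: the parent is uniform in its block
    have hsum : ∑ j : Fin (n + 1), ∫ ω, A j ω * d j ω ∂μ =
        ∑ j : Fin (n + 1), ∫ ω, A j ω * R j ω ∂μ := by
      rw [← integral_finsetSum Finset.univ (f := fun (j : Fin (n + 1)) ω => A j ω * d j ω)
          fun j _ => hAd j,
        ← integral_finsetSum Finset.univ (f := fun (j : Fin (n + 1)) ω => A j ω * R j ω)
          fun j _ => hAR j j.2]
      refine integral_congr_ae (ae_of_all _ fun ω => ?_)
      change ∑ j : Fin (n + 1), A j ω * d j ω = ∑ j : Fin (n + 1), A j ω * R j ω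
      rw [Fin.sum_univ_eq_sum_range (fun j => A j ω * d j ω),
        Fin.sum_univ_eq_sum_range (fun j => A j ω * R j ω)]
      refine (sum_mul_class_mean (W ω s) (n + 1) (fun j => A j ω) (fun j => d j ω) ?_).symm
      exact fun j k hjk => hloc _ _ fun r hr => attach_eq_of_rel (part_anti hr n hjk)
    have hpoint : ∀ (j : Fin (n + 1)) (b : ℝ), ∫ ω, F (step n (W ω) j b) ∂μ =
        ∫ ω, H (step n (W ω) j b) ∂μ +
        ((Set.Ioi (s : ℝ)).indicator (fun _ => Real.exp (-t) *
          (∫ ω, A j ω * c ω ∂μ - ∫ ω, A j ω * R j ω ∂μ)) b +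
        (Set.Ioi ((s + t : ℝ≥0) : ℝ)).indicator (fun _ =>
          ∫ ω, A j ω * d j ω ∂μ - ∫ ω, A j ω * c ω ∂μ) b) := by
      intro j b
      have hpair : Measurable fun x : ℝ≥0 → NatPartition => (x, j, b) :=
        measurable_id.prodMk measurable_const
      have hΦ' : Measurable fun x => Φ (step n x j b) :=
        hΦ.comp ((measurable_step n).comp hpair)
      have hloc' : ∀ x y, (∀ r ≤ s, x r = y r) → Φ (step n x j b) = Φ (step n y j b) :=
        fun x y hxy => hloc _ _ fun r hr => by simp only [step, hxy r hr]
      have hst : (s : ℝ) ≤ ((s + t : ℝ≥0) : ℝ) := NNReal.coe_le_coe.2 le_self_add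
      -- for an attached vertex the past is `A j`
      have hA : (s : ℝ) < b → ∀ ω, Φ (step n (W ω) j b) = A j ω := fun hb ω =>
        hloc _ _ fun r hr => if_pos ((NNReal.coe_le_coe.2 hr).trans_lt hb)
      have hHs : (s : ℝ) < b → ∫ ω, H (step n (W ω) j b) ∂μ =
          (1 - Real.exp (-t)) * ∫ ω, A j ω * c ω ∂μ +
            Real.exp (-t) * ∫ ω, A j ω * R j ω ∂μ := by
        intro hb
        rw [← integral_const_mul, ← integral_const_mul,
          ← integral_add ((hAc j).const_mul _) ((hAR j j.2).const_mul _)]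
        refine integral_congr_ae (ae_of_all _ fun ω => ?_)
        have hs : step n (W ω) j b s = attach (W ω s) (n + 1) j := if_pos hb
        simp only [hHdef, hA hb ω, hs, hsemi j j.2 ω]
        ring
      by_cases hb2 : ((s + t : ℝ≥0) : ℝ) < b
      · have hb1 : (s : ℝ) < b := hst.trans_lt hb2
        rw [Set.indicator_of_mem (Set.mem_Ioi.2 hb1), Set.indicator_of_mem (Set.mem_Ioi.2 hb2),
          hHs hb1]
        have := ih hΦ' (fun x => hC _) hloc' (f := fun τ => f (attach τ (n + 1) j))
          (hf.comp (measurable_attach _ _)) fun τ => hC' _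
        have hF' : ∫ ω, F (step n (W ω) j b) ∂μ = ∫ ω, A j ω * d j ω ∂μ := by
          refine Eq.trans ?_ (this.trans ?_)
          · refine integral_congr_ae (ae_of_all _ fun ω => ?_)
            have hs : step n (W ω) j b (s + t) = attach (W ω (s + t)) (n + 1) j := if_pos hb2
            simp only [hFdef, hs]
            rfl
          · exact integral_congr_ae (ae_of_all _ fun ω => congrArg (· * d j ω) (hA hb1 ω))
        rw [hF']
        ring
      · have hF' : ∫ ω, F (step n (W ω) j b) ∂μ = ∫ ω, Φ (step n (W ω) j b) * c ω ∂μ := by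
          refine Eq.trans ?_ (ih hΦ' (fun x => hC _) hloc' hf hC')
          refine integral_congr_ae (ae_of_all _ fun ω => ?_)
          have hs : step n (W ω) j b (s + t) = W ω (s + t) := if_neg hb2
          simp only [hFdef, hs]
          rfl
        rw [Set.indicator_of_notMem (s := Set.Ioi ((s + t : ℝ≥0) : ℝ)) (a := b) hb2, hF']
        by_cases hb1 : (s : ℝ) < b
        · rw [Set.indicator_of_mem (Set.mem_Ioi.2 hb1), hHs hb1]
          simp only [hA hb1]
          ring
        · rw [Set.indicator_of_notMem (s := Set.Ioi (s : ℝ)) (a := b) hb1]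
          rw [add_zero, add_zero]
          refine integral_congr_ae (ae_of_all _ fun ω => ?_)
          have hs : step n (W ω) j b s = W ω s := if_neg hb1
          simp only [hHdef, hs]
          rw [semi_of_isolated t (isolatedFrom_part n)]
    have hexp : Real.exp (-((s + t : ℝ≥0) : ℝ)) = Real.exp (-s) * Real.exp (-t) := by
      rw [← Real.exp_add]; push_cast; ring_nf
    have hint_b : ∀ j : Fin (n + 1), ∫ b, ∫ ω, F (step n (W ω) j b) ∂μ ∂(expMeasure 1) =
        ∫ b, ∫ ω, H (step n (W ω) j b) ∂μ ∂(expMeasure 1) +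
          Real.exp (-s) * Real.exp (-t) *
            (∫ ω, A j ω * d j ω ∂μ - ∫ ω, A j ω * R j ω ∂μ) := by
      intro j
      refine (integral_congr_ae (ae_of_all _ (hpoint j))).trans
        ((integral_expMeasure_add_indicator (h.integrable_path_step n hH hHC j) s.2
          (s + t).2 _ _).trans ?_)
      change _ + (Real.exp (-(s : ℝ)) * _ + Real.exp (-((s + t : ℝ≥0) : ℝ)) * _) = _
      rw [hexp]
      ring
    rw [Finset.sum_congr rfl fun j _ => hint_b j, Finset.sum_add_distrib, ← Finset.mul_sum,
      Finset.sum_sub_distrib, hsum, sub_self, mul_zero, add_zero]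

end IsTreeDestruction

/-! ### The Markov property -/

theorem withDensity_map_integral {Ω E : Type*} [MeasurableSpace Ω] {μ : Measure Ω}
    [MeasurableSpace E] {X : Ω → E} (hX : Measurable X) {Y : Ω → ℝ} (hY : Measurable Y)
    (h0 : ∀ ω, 0 ≤ Y ω) {g : E → ℝ} (hg : Measurable g) :
    ∫ x, g x ∂((μ.withDensity fun ω => ((Y ω).toNNReal : ℝ≥0∞)).map X) =
      ∫ ω, g (X ω) * Y ω ∂μ := by
  rw [integral_map hX.aemeasurable hg.aestronglyMeasurable,
    integral_withDensity_eq_integral_smul hY.real_toNNReal]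
  refine integral_congr_ae (ae_of_all _ fun ω => ?_)
  simp only [NNReal.smul_def, Real.coe_toNNReal _ (h0 ω), smul_eq_mul, mul_comm]

/-- Nonnegative integrable variables with the same integrals against continuous functions of `X`
have the same integrals over all events determined by `X`. -/
theorem setIntegral_preimage_eq {Ω E : Type*} [MeasurableSpace Ω] {μ : Measure Ω}
    [MeasurableSpace E] [TopologicalSpace E] [HasOuterApproxClosed E] [BorelSpace E]
    {X : Ω → E} (hX : Measurable X) {Y Y' : Ω → ℝ} (hY : Measurable Y) (hY' : Measurable Y')
    (hYi : Integrable Y μ) (hYi' : Integrable Y' μ) (h0 : ∀ ω, 0 ≤ Y ω) (h0' : ∀ ω, 0 ≤ Y' ω)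
    (h : ∀ φ : BoundedContinuousFunction E ℝ, ∫ ω, φ (X ω) * Y ω ∂μ = ∫ ω, φ (X ω) * Y' ω ∂μ)
    {B : Set E} (hB : MeasurableSet B) :
    ∫ ω in X ⁻¹' B, Y ω ∂μ = ∫ ω in X ⁻¹' B, Y' ω ∂μ := by
  have hfin : ∀ {Z : Ω → ℝ}, Integrable Z μ →
      IsFiniteMeasure (μ.withDensity fun ω => ((Z ω).toNNReal : ℝ≥0∞)) := fun hZ =>
    isFiniteMeasure_withDensity_ofReal hZ.2
  have := hfin hYi
  have := hfin hYi'
  have heq : (μ.withDensity fun ω => ((Y ω).toNNReal : ℝ≥0∞)).map X =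
      (μ.withDensity fun ω => ((Y' ω).toNNReal : ℝ≥0∞)).map X := by
    refine ext_of_forall_integral_eq_of_IsFiniteMeasure fun φ => ?_
    rw [withDensity_map_integral hX hY h0 φ.continuous.measurable,
      withDensity_map_integral hX hY' h0' φ.continuous.measurable, h]
  have hind : Measurable (B.indicator fun _ => (1 : ℝ)) := measurable_const.indicator hB
  have key : ∀ {Z : Ω → ℝ}, ∫ ω, (B.indicator fun _ => (1 : ℝ)) (X ω) * Z ω ∂μ =
      ∫ ω in X ⁻¹' B, Z ω ∂μ := by
    intro Z
    rw [← integral_indicator (hX hB)]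
    refine integral_congr_ae (ae_of_all _ fun ω => ?_)
    change (B.indicator fun _ => (1 : ℝ)) (X ω) * Z ω = _
    by_cases hω : X ω ∈ B
    · rw [Set.indicator_of_mem hω, Set.indicator_of_mem (s := X ⁻¹' B) hω, one_mul]
    · rw [Set.indicator_of_notMem hω, Set.indicator_of_notMem (s := X ⁻¹' B) hω, zero_mul]
  rw [← key, ← key, ← withDensity_map_integral hX hY h0 hind,
    ← withDensity_map_integral hX hY' h0' hind, heq]

namespace IsTreeDestruction

open NatPartition

theorem destruction_agreeOn_part {Ω : Type*} (u : (i : ℕ) → Ω → Fin (i + 1)) (e : ℕ → Ω → ℝ)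
    (t : ℝ≥0) (ω : Ω) (n : ℕ) :
    AgreeOn (n + 1) (destruction u e t ω) (part (fun i => u i ω) (fun i => e i ω) t n) :=
  fun _ hx _ hy => part_rel_iff_reachable hx hy

theorem tendsto_part {Ω : Type*} (u : (i : ℕ) → Ω → Fin (i + 1)) (e : ℕ → Ω → ℝ) (t : ℝ≥0)
    (ω : Ω) :
    Tendsto (fun n => part (fun i => u i ω) (fun i => e i ω) t n) atTop
      (𝓝 (destruction u e t ω)) := by
  rw [tendsto_iff_dist_tendsto_zero]
  refine squeeze_zero (fun _ => dist_nonneg) (fun n => ?_) tendsto_one_div_add_atTop_nhds_zero_nat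
  have := dist_le_of_agreeOn (by omega) (destruction_agreeOn_part u e t ω n).symm
  push_cast at this
  exact this

theorem pastSigma_eq_generateFrom {Ω : Type*} (u : (i : ℕ) → Ω → Fin (i + 1)) (e : ℕ → Ω → ℝ)
    (s : ℝ≥0) :
    pastSigma (destruction u e) s = MeasurableSpace.generateFrom (piiUnionInter
      (fun r : Set.Iic s => {A | MeasurableSet[MeasurableSpace.comap
        (destruction u e r) inferInstance] A}) Set.univ) := by
  have := generateFrom_piiUnionInter_measurableSet
    (fun r : Set.Iic s => MeasurableSpace.comap (destruction u e r) inferInstance) Set.univ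
  simp only [Set.mem_univ, iSup_pos] at this
  exact this.symm

variable {Ω : Type*} [MeasurableSpace Ω] {μ : Measure Ω}
  {u : (i : ℕ) → Ω → Fin (i + 1)} {e : ℕ → Ω → ℝ}

theorem measurable_destruction (h : IsTreeDestruction μ u e) (t : ℝ≥0) :
    Measurable (destruction u e t) := by
  refine measurable_of_rel fun i j => ?_
  have : {ω | (destruction u e t ω).rel i j} =
      {ω | (part (fun i => u i ω) (fun i => e i ω) t (i + j)).rel i j} := by
    ext ω
    exact destruction_agreeOn_part u e t ω (i + j) i (by omega) j (by omega)
  rw [this]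
  exact measurableSet_rel (h.measurable_part_apply (i + j) t) i j

/-- The Markov property, tested against continuous functions of the past at finitely many times. -/
theorem integral_destruction_mul [IsProbabilityMeasure μ] (h : IsTreeDestruction μ u e)
    (s t : ℝ≥0) (S : Finset (Set.Iic s)) (φ : BoundedContinuousFunction (S → NatPartition) ℝ)
    (f : C(NatPartition, ℝ)) :
    ∫ ω, φ (fun r => destruction u e r.1 ω) * f (destruction u e (s + t) ω) ∂μ =
      ∫ ω, φ (fun r => destruction u e r.1 ω) * transOp t f (destruction u e s ω) ∂μ := by
  let P : ℝ≥0 → ℕ → Ω → NatPartition := fun r n ω => part (fun i => u i ω) (fun i => e i ω) r n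
  have hP : ∀ r n, Measurable (P r n) := fun r n => h.measurable_part_apply n r
  have hφP : ∀ n, Measurable fun ω => φ fun r : S => P r.1 n ω := fun n =>
    φ.continuous.measurable.comp (measurable_pi_lambda _ fun r => hP _ n)
  have hφlim : ∀ ω, Tendsto (fun n => φ fun r : S => P r.1 n ω) atTop
      (𝓝 (φ fun r => destruction u e r.1 ω)) := fun ω =>
    (φ.continuous.tendsto _).comp (tendsto_pi_nhds.2 fun r => tendsto_part u e r.1 ω)
  have hb : ∀ x, |φ x| ≤ ‖φ‖ := fun x => φ.norm_coe_le_norm x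
  have hbf : ∀ x, |f x| ≤ ‖f‖ := fun x => f.norm_coe_le_norm x
  have hbd : ∀ x y : ℝ, |x| ≤ ‖φ‖ → |y| ≤ ‖f‖ → ‖x * y‖ ≤ ‖φ‖ * ‖f‖ := fun x y hx hy => by
    rw [norm_mul]; exact mul_le_mul hx hy (abs_nonneg _) (norm_nonneg _)
  have hfin : ∀ n, ∫ ω, φ (fun r : S => P r.1 n ω) * f (P (s + t) n ω) ∂μ =
      ∫ ω, φ (fun r : S => P r.1 n ω) * semi t (n + 1) (P s n ω) f ∂μ := fun n =>
    h.integral_part_mul s t n (Φ := fun x => φ fun r : S => x r.1)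
      (φ.continuous.measurable.comp (measurable_pi_lambda _ fun r => measurable_pi_apply _))
      (fun _ => hb _) (fun x y hxy => congrArg φ (funext fun r => hxy _ r.1.2))
      f.continuous.measurable hbf
  have h1 : Tendsto (fun n => ∫ ω, φ (fun r : S => P r.1 n ω) * f (P (s + t) n ω) ∂μ) atTop
      (𝓝 (∫ ω, φ (fun r => destruction u e r.1 ω) * f (destruction u e (s + t) ω) ∂μ)) := by
    refine tendsto_integral_of_dominated_convergence (fun _ => ‖φ‖ * ‖f‖)
      (fun n => ((hφP n).mul (f.continuous.measurable.comp (hP _ n))).aestronglyMeasurable)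
      (integrable_const _) (fun n => ae_of_all _ fun ω => hbd _ _ (hb _) (hbf _))
      (ae_of_all _ fun ω => (hφlim ω).mul ((f.continuous.tendsto _).comp (tendsto_part u e _ ω)))
  have h2 : Tendsto (fun n => ∫ ω, φ (fun r : S => P r.1 n ω) * semi t (n + 1) (P s n ω) f ∂μ)
      atTop
      (𝓝 (∫ ω, φ (fun r => destruction u e r.1 ω) * transOp t f (destruction u e s ω) ∂μ)) := by
    refine tendsto_integral_of_dominated_convergence (fun _ => ‖φ‖ * ‖f‖)
      (fun n => ((hφP n).mul ((measurable_semi t (n + 1) f).comp (hP _ n))).aestronglyMeasurable)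
      (integrable_const _)
      (fun n => ae_of_all _ fun ω => hbd _ _ (hb _) (abs_semi_le t.2 _ _ hbf))
      (ae_of_all _ fun ω => (hφlim ω).mul ?_)
    refine ((tendsto_semi t f (destruction u e s ω)).comp (tendsto_add_atTop_nat 1)).congr
      fun n => ?_
    rw [Function.comp_apply, (destruction_agreeOn_part u e s ω n).semi_eq]
  exact tendsto_nhds_unique h1 (h2.congr fun n => (hfin n).symm)

theorem setIntegral_destruction [IsProbabilityMeasure μ] (h : IsTreeDestruction μ u e)
    (s t : ℝ≥0) (S : Finset (Set.Iic s)) (f : C(NatPartition, ℝ)) {B : Set (S → NatPartition)}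
    (hB : MeasurableSet B) :
    ∫ ω in (fun ω (r : S) => destruction u e r.1 ω) ⁻¹' B, f (destruction u e (s + t) ω) ∂μ =
      ∫ ω in (fun ω (r : S) => destruction u e r.1 ω) ⁻¹' B,
        transOp t f (destruction u e s ω) ∂μ := by
  have hm : ∀ (g : C(NatPartition, ℝ)) r, Measurable fun ω => g (destruction u e r ω) :=
    fun g r => g.continuous.measurable.comp (h.measurable_destruction r)
  have hi : ∀ (g : C(NatPartition, ℝ)) r, Integrable (fun ω => g (destruction u e r ω)) μ :=
    fun g r => Integrable.of_bound (hm g r).aestronglyMeasurable ‖g‖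
      (ae_of_all _ fun ω => g.norm_coe_le_norm _)
  -- adding a constant makes `f` nonnegative
  let c : C(NatPartition, ℝ) := ‖f‖ • 1
  have hc : ∀ η, c η = ‖f‖ := fun η => by simp [c]
  have htc : transOp t c = c := by rw [map_smul, transOp_one]
  have hfc : 0 ≤ f + c := fun η => by
    have := (abs_le.1 (f.norm_coe_le_norm η)).1
    change 0 ≤ f η + c η
    rw [hc]
    linarith
  have hX : Measurable fun ω (r : S) => destruction u e r.1 ω :=
    measurable_pi_lambda _ fun r => h.measurable_destruction _
  have key := setIntegral_preimage_eq hX (hm (f + c) (s + t)) (hm (transOp t (f + c)) s)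
    (hi _ _) (hi _ _) (fun ω => hfc _) (fun ω => transOp_nonneg t _ hfc _)
    (fun φ => h.integral_destruction_mul s t S φ (f + c)) hB
  rw [map_add, htc] at key
  simp only [ContinuousMap.add_apply, hc] at key
  rw [integral_add (hi _ _).integrableOn (integrable_const _),
    integral_add (hi _ _).integrableOn (integrable_const _)] at key
  linarith

theorem pastSigma_le (h : IsTreeDestruction μ u e) (s : ℝ≥0) :
    pastSigma (destruction u e) s ≤ ‹MeasurableSpace Ω› :=
  iSup_le fun r => (h.measurable_destruction r).comap_le

theorem condExp_destruction [IsProbabilityMeasure μ] (h : IsTreeDestruction μ u e) (s t : ℝ≥0)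
    (f : C(NatPartition, ℝ)) :
    μ[fun ω => f (destruction u e (s + t) ω) | pastSigma (destruction u e) s] =ᵐ[μ]
      fun ω => transOp t f (destruction u e s ω) := by
  have hm : ∀ (g : C(NatPartition, ℝ)) r, Measurable fun ω => g (destruction u e r ω) :=
    fun g r => g.continuous.measurable.comp (h.measurable_destruction r)
  have hi : ∀ (g : C(NatPartition, ℝ)) r, Integrable (fun ω => g (destruction u e r ω)) μ :=
    fun g r => Integrable.of_bound (hm g r).aestronglyMeasurable ‖g‖
      (ae_of_all _ fun ω => g.norm_coe_le_norm _)
  have hle := h.pastSigma_le s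
  refine (ae_eq_condExp_of_forall_setIntegral_eq hle (hi f (s + t))
    (fun _ _ _ => (hi _ _).integrableOn) (fun A hA _ => ?_) ?_).symm
  · induction A, hA using MeasurableSpace.induction_on_inter
      (pastSigma_eq_generateFrom u e s)
      (isPiSystem_piiUnionInter _ (fun r : Set.Iic s => @MeasurableSpace.isPiSystem_measurableSet _
        (MeasurableSpace.comap (destruction u e r) inferInstance)) _) with
    | empty => simp
    | basic A hA =>
      classical
      obtain ⟨S, -, B, hB, rfl⟩ := hA
      choose! C hC hCB using hB
      have hset : ⋂ r ∈ S, B r = (fun ω (r : S) => destruction u e r.1 ω) ⁻¹'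
          (Set.univ.pi fun r : S => C r) := by
        ext ω
        simp only [Set.mem_iInter, Set.mem_preimage, Set.mem_pi, Set.mem_univ, forall_true_left,
          Subtype.forall]
        refine ⟨fun hω r hr hrS => ?_, fun hω r hr hrS => ?_⟩
        · have := hω r hr hrS
          rwa [← hCB _ hrS] at this
        · rw [← hCB _ hrS]
          exact hω r hr hrS
      rw [hset]
      exact (h.setIntegral_destruction s t S f
        (MeasurableSet.univ_pi fun r => hC _ r.2)).symm
    | compl A hA ih =>
      have hA' := hle A hA
      have htot := h.setIntegral_destruction s t ∅ f MeasurableSet.univ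
      simp only [Set.preimage_univ, Measure.restrict_univ] at htot
      rw [setIntegral_compl hA' (hi _ _), setIntegral_compl hA' (hi _ _), htot,
        ih (measure_lt_top _ _)]
    | iUnion A hd hA ih =>
      have hA' := fun i => hle (A i) (hA i)
      rw [integral_iUnion hA' hd (hi _ _).integrableOn,
        integral_iUnion hA' hd (hi _ _).integrableOn]
      exact tsum_congr fun i => ih i (measure_lt_top _ _)
  · have hms : Measurable[pastSigma (destruction u e) s] (destruction u e s) :=
      (comap_measurable _).mono (le_iSup (fun r : Set.Iic s => MeasurableSpace.comap
        (destruction u e r) inferInstance) ⟨s, Set.mem_Iic.2 le_rfl⟩) le_rfl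
    exact ((transOp t f).continuous.measurable.comp hms).aestronglyMeasurable

end IsTreeDestruction

/-! ### Full support and the semigroup -/

theorem pastSigma_mono {Ω E : Type*} [MeasurableSpace E] (X : ℝ≥0 → Ω → E) {s t : ℝ≥0}
    (hst : s ≤ t) : pastSigma X s ≤ pastSigma X t :=
  iSup_le fun r => le_iSup (fun r : Set.Iic t => MeasurableSpace.comap (X r) inferInstance)
    ⟨r, Set.mem_Iic.2 ((Set.mem_Iic.1 r.2).trans hst)⟩

namespace NatPartition

/-- The partition with a single block. -/
def single : NatPartition := ⟨fun _ _ => True, fun _ => trivial, fun _ => trivial,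
  fun _ _ => trivial⟩

end NatPartition

namespace IsTreeDestruction

open NatPartition

variable {Ω : Type*} [MeasurableSpace Ω] {μ : Measure Ω}
  {u : (i : ℕ) → Ω → Fin (i + 1)} {e : ℕ → Ω → ℝ}

theorem ae_removal_pos (h : IsTreeDestruction μ u e) : ∀ᵐ ω ∂μ, ∀ i, 0 < e i ω := by
  have := isProbabilityMeasure_expMeasure one_pos
  rw [ae_all_iff]
  intro i
  have h1 : Set.Ioi (0 : ℝ) ∈ ae (expMeasure 1) := by
    rw [mem_ae_iff_prob_eq_one measurableSet_Ioi, ← ENNReal.toReal_eq_one_iff]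
    exact (expMeasure_one_real_Ioi le_rfl).trans (by simp)
  rw [← h.law_time i] at h1
  exact ae_of_ae_map (h.measurable_time i).aemeasurable h1

/-- The destruction starts from the partition with a single block. -/
theorem destruction_zero_ae_eq (h : IsTreeDestruction μ u e) :
    ∀ᵐ ω ∂μ, destruction u e 0 ω = single := by
  filter_upwards [h.ae_removal_pos] with ω hω
  have key : ∀ x, (destruction u e 0 ω).rel x 0 := by
    intro x
    induction x using Nat.strong_induction_on with
    | _ x ih =>
      rcases x with _ | i
      · exact (destruction u e 0 ω).iseqv.refl 0
      · have hlt := (u i ω).2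
        refine (destruction u e 0 ω).iseqv.trans ?_ (ih (u i ω) (by omega))
        refine SimpleGraph.Adj.reachable ?_
        exact (SimpleGraph.fromRel_adj _ _ _).2 ⟨by omega, Or.inl ⟨i, rfl, rfl, hω i⟩⟩
  ext x y
  exact iff_of_true ((destruction u e 0 ω).iseqv.trans (key x)
    ((destruction u e 0 ω).iseqv.symm (key y))) trivial

theorem integral_destruction [IsProbabilityMeasure μ] (h : IsTreeDestruction μ u e) (t : ℝ≥0)
    (f : C(NatPartition, ℝ)) : ∫ ω, f (destruction u e t ω) ∂μ = transOp t f single := by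
  have key := h.setIntegral_destruction 0 t ∅ f MeasurableSet.univ
  simp only [Set.preimage_univ, Measure.restrict_univ, zero_add] at key
  rw [key, integral_congr_ae (g := fun _ => transOp t f single)
    (h.destruction_zero_ae_eq.mono fun ω hω => by simp only [hω])]
  simp

/-- The law of the destruction at a positive time has full support: a continuous function is
determined by its values along the process. -/
theorem eq_of_ae_eq [IsProbabilityMeasure μ] (h : IsTreeDestruction μ u e) {t : ℝ≥0} (ht : 0 < t)
    {f g : C(NatPartition, ℝ)}
    (hfg : ∀ᵐ ω ∂μ, f (destruction u e t ω) = g (destruction u e t ω)) : f = g := by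
  classical
  by_contra hne
  obtain ⟨η, hη⟩ : ∃ η, f η ≠ g η := by
    by_contra! hall
    exact hne (ContinuousMap.ext hall)
  obtain ⟨r, hr, hball⟩ := Metric.isOpen_iff.1
    (isOpen_ne_fun f.continuous g.continuous) η hη
  obtain ⟨n, hn⟩ := exists_nat_one_div_lt hr
  have hne' : ∀ π, AgreeOn (n + 1) π η → f π ≠ g π := fun π hπ => by
    refine hball ?_
    have := dist_le_of_agreeOn (by omega) hπ
    push_cast at this
    exact this.trans_lt hn
  -- the indicator of the neighbourhood of `η` on which the two functions differ
  let φ : NatPartition → ℝ := fun π => if AgreeOn (n + 1) π η then 1 else 0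
  have hφ : ∀ π ρ, AgreeOn (n + 1) π ρ → φ π = φ ρ := fun π ρ hπρ => by
    have : AgreeOn (n + 1) π η ↔ AgreeOn (n + 1) ρ η :=
      ⟨fun h' => hπρ.symm.trans h', fun h' => hπρ.trans h'⟩
    simp only [φ, this]
  have hzero : ∫ ω, ofAgreeOn (n + 1) φ hφ (destruction u e t ω) ∂μ = 0 := by
    refine integral_eq_zero_of_ae (hfg.mono fun ω hω => ?_)
    exact if_neg fun hag => hne' _ hag hω
  rw [h.integral_destruction, transOp_eq_semiOp t (ofAgreeOn_mem hφ)] at hzero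
  refine (semi_pos (NNReal.coe_pos.2 ht) (η := single) (fun _ _ => trivial) η (n + 1) (g := φ)
    (fun σ => ?_) ?_).ne' hzero
  · by_cases hσ : AgreeOn (n + 1) σ η <;> simp [φ, hσ]
  · simp [φ, trunc_agreeOn]

theorem transOp_add [IsProbabilityMeasure μ] (h : IsTreeDestruction μ u e) (s t : ℝ≥0) :
    transOp (s + t) = (transOp s).comp (transOp t) := by
  refine ContinuousLinearMap.ext fun f => h.eq_of_ae_eq one_pos ?_
  have h1 := h.condExp_destruction 1 (s + t) f
  have h2 := h.condExp_destruction (1 + s) t f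
  have h3 := h.condExp_destruction 1 s (transOp t f)
  have h4 := condExp_condExp_of_le (μ := μ) (f := fun ω => f (destruction u e (1 + s + t) ω))
    (pastSigma_mono (destruction u e) (le_self_add (a := 1) (b := s))) (h.pastSigma_le (1 + s))
  rw [← add_assoc] at h1
  exact h1.symm.trans (h4.symm.trans ((condExp_congr_ae h2).trans h3))

/-- The Feller semigroup of the destruction process. -/
noncomputable def semigroup [IsProbabilityMeasure μ] (h : IsTreeDestruction μ u e) :
    FellerSemigroup NatPartition where
  op := transOp
  op_zero := transOp_zero
  op_add := h.transOp_add
  op_nonneg := transOp_nonneg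
  op_one := transOp_one
  tendsto_zero := tendsto_transOp_zero

theorem isMarkovWith [IsProbabilityMeasure μ] (h : IsTreeDestruction μ u e) :
    IsMarkovWith μ (destruction u e) h.semigroup :=
  ⟨h.measurable_destruction, h.condExp_destruction⟩

theorem eq_semigroup [IsProbabilityMeasure μ] (h : IsTreeDestruction μ u e)
    (T : FellerSemigroup NatPartition) (hT : IsMarkovWith μ (destruction u e) T) :
    T = h.semigroup := by
  refine FellerSemigroup.ext (funext fun t => ContinuousLinearMap.ext fun f => ?_)
  exact h.eq_of_ae_eq one_pos ((hT.condExp_eq 1 t f).symm.trans (h.condExp_destruction 1 t f))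

theorem hasGenerator [IsProbabilityMeasure μ] (h : IsTreeDestruction μ u e) {n : ℕ}
    {f : C(NatPartition, ℝ)} (hf : f ∈ D n) : h.semigroup.HasGenerator f (genFun n f) :=
  tendsto_transOp_slope hf

end IsTreeDestruction

/-! ### A criterion for cores of Feller semigroups -/

namespace FellerSemigroup

variable {E : Type*} [TopologicalSpace E] [CompactSpace E]

theorem norm_op_le (T : FellerSemigroup E) (t : ℝ≥0) (f : C(E, ℝ)) : ‖T.op t f‖ ≤ ‖f‖ := by
  have hc : T.op t (‖f‖ • 1) = ‖f‖ • 1 := by rw [map_smul, T.op_one]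
  have h1 : 0 ≤ T.op t (‖f‖ • 1 - f) := T.op_nonneg t _ fun x => by
    have := (abs_le.1 (f.norm_coe_le_norm x)).2
    simpa using this
  have h2 : 0 ≤ T.op t (‖f‖ • 1 + f) := T.op_nonneg t _ fun x => by
    have := (abs_le.1 (f.norm_coe_le_norm x)).1
    have h3 : 0 ≤ ‖f‖ + f x := by linarith
    simpa using h3
  rw [map_sub, hc] at h1
  rw [map_add, hc] at h2
  refine (ContinuousMap.norm_le _ (norm_nonneg _)).2 fun x => ?_
  have h1' : 0 ≤ ‖f‖ * 1 - T.op t f x := h1 x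
  have h2' : 0 ≤ ‖f‖ * 1 + T.op t f x := h2 x
  exact abs_le.2 ⟨by linarith, by linarith⟩

theorem HasGenerator.sub {T : FellerSemigroup E} {f g f' g' : C(E, ℝ)}
    (h : T.HasGenerator f g) (h' : T.HasGenerator f' g') :
    T.HasGenerator (f - f') (g - g') := by
  have := h.add (h'.smul (-1))
  simpa [sub_eq_add_neg] using this

theorem mem_generator_graph_iff {T : FellerSemigroup E} {f g : C(E, ℝ)} :
    (f, g) ∈ T.generator.graph ↔ T.HasGenerator f g := by
  rw [LinearPMap.mem_graph_iff]
  constructor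
  · rintro ⟨y, rfl, rfl⟩
    exact y.2.choose_spec
  · intro h
    exact ⟨⟨f, g, h⟩, rfl, (Exists.choose_spec (⟨g, h⟩ : ∃ g, T.HasGenerator f g)).unique h⟩

theorem HasGenerator.generator_apply {T : FellerSemigroup E} {f g : C(E, ℝ)}
    (h : T.HasGenerator f g) (hf : f ∈ T.generator.domain) : T.generator ⟨f, hf⟩ = g :=
  hf.choose_spec.unique h

/-- The generator is dissipative. -/
theorem HasGenerator.norm_le {T : FellerSemigroup E} {f g : C(E, ℝ)} (h : T.HasGenerator f g) :
    ‖f‖ ≤ ‖f - g‖ := by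
  refine ge_of_tendsto ((tendsto_const_nhds (x := f)).sub h).norm ?_
  filter_upwards [self_mem_nhdsWithin] with t ht
  have ht' : (0 : ℝ) < t := NNReal.coe_pos.2 ht
  have h1 : f - (t : ℝ)⁻¹ • (T.op t f - f) = (1 + (t : ℝ)⁻¹) • f - (t : ℝ)⁻¹ • T.op t f := by
    module
  have h2 := norm_sub_norm_le ((1 + (t : ℝ)⁻¹) • f) ((t : ℝ)⁻¹ • T.op t f)
  rw [norm_smul, norm_smul, Real.norm_of_nonneg (by positivity),
    Real.norm_of_nonneg (by positivity)] at h2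
  have h3 := mul_le_mul_of_nonneg_left (T.norm_op_le t f) (inv_pos.2 ht').le
  rw [h1]
  linarith

/-- A telescoping sum over `k` time steps of length `r`. -/
theorem norm_op_nsmul_sub_le (T : FellerSemigroup E) (f g : C(E, ℝ)) {t r : ℝ≥0} {M : ℝ}
    (hM : ∀ s ≤ t, ‖T.op s g - g‖ ≤ M) (k : ℕ) (hk : k * r ≤ t) :
    ‖T.op (k * r) f - f - ((k * r : ℝ≥0) : ℝ) • g‖ ≤
      k * ‖T.op r f - f - (r : ℝ) • g‖ + ((k * r : ℝ≥0) : ℝ) * M := by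
  induction k with
  | zero => simp [T.op_zero]
  | succ k ih =>
    have hk' : (k : ℝ≥0) * r ≤ t := le_trans (by gcongr; simp) hk
    have hsplit : T.op ((k + 1 : ℕ) * r) f - f - (((k + 1 : ℕ) * r : ℝ≥0) : ℝ) • g =
        T.op (k * r) (T.op r f - f - (r : ℝ) • g) + (r : ℝ) • (T.op (k * r) g - g) +
          (T.op (k * r) f - f - ((k * r : ℝ≥0) : ℝ) • g) := by
      have h1 : ((k + 1 : ℕ) : ℝ≥0) * r = k * r + r := by push_cast; ring
      rw [h1, T.op_add, map_sub, map_sub, map_smul, ContinuousLinearMap.comp_apply]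
      push_cast
      module
    rw [hsplit]
    have h1 := norm_add₃_le (a := T.op (k * r) (T.op r f - f - (r : ℝ) • g))
      (b := (r : ℝ) • (T.op (k * r) g - g)) (c := T.op (k * r) f - f - ((k * r : ℝ≥0) : ℝ) • g)
    have h2 := T.norm_op_le (k * r) (T.op r f - f - (r : ℝ) • g)
    have h3 := mul_le_mul_of_nonneg_left (hM _ hk') (NNReal.coe_nonneg r)
    rw [norm_smul, Real.norm_of_nonneg (NNReal.coe_nonneg r)] at h1
    have h4 := ih hk'
    push_cast at h1 h4 ⊢
    linarith

theorem HasGenerator.norm_op_sub_le {T : FellerSemigroup E} {f g : C(E, ℝ)}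
    (h : T.HasGenerator f g) {t : ℝ≥0} (ht : 0 < t) {M : ℝ}
    (hM : ∀ s ≤ t, ‖T.op s g - g‖ ≤ M) : ‖T.op t f - f - (t : ℝ) • g‖ ≤ t * M := by
  have ht' : (0 : ℝ) < t := NNReal.coe_pos.2 ht
  have hr : Tendsto (fun k : ℕ => t / ((k + 1 : ℕ) : ℝ≥0)) atTop (𝓝[>] 0) := by
    refine tendsto_nhdsWithin_iff.2 ⟨?_, Eventually.of_forall fun k => ?_⟩
    · exact (tendsto_const_div_atTop_nhds_zero_nat t).comp (tendsto_add_atTop_nat 1)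
    · exact Set.mem_Ioi.2 (by positivity)
  have h1 : Tendsto (fun k : ℕ => t * ‖((t / ((k + 1 : ℕ) : ℝ≥0) : ℝ≥0) : ℝ)⁻¹ •
      (T.op (t / ((k + 1 : ℕ) : ℝ≥0)) f - f) - g‖ + t * M) atTop (𝓝 (t * M)) := by
    have := (((h.comp hr).sub_const g).norm.const_mul (t : ℝ)).add_const (t * M)
    simpa using this
  refine ge_of_tendsto h1 (Eventually.of_forall fun k => ?_)
  set r : ℝ≥0 := t / ((k + 1 : ℕ) : ℝ≥0) with hrdef
  have hr0 : 0 < r := by positivity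
  have hkr : ((k + 1 : ℕ) : ℝ≥0) * r = t := by rw [hrdef]; field_simp
  have h2 := T.norm_op_nsmul_sub_le f g hM (k + 1) hkr.le
  rw [hkr] at h2
  refine h2.trans_eq ?_
  have h3 : T.op r f - f - (r : ℝ) • g = (r : ℝ) • ((r : ℝ)⁻¹ • (T.op r f - f) - g) := by
    rw [smul_sub, smul_smul, mul_inv_cancel₀ (NNReal.coe_ne_zero.2 hr0.ne'), one_smul]
  rw [h3, norm_smul, Real.norm_of_nonneg (NNReal.coe_nonneg r), ← mul_assoc]
  congr 2
  exact_mod_cast congrArg NNReal.toReal hkr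

theorem isClosed_generator (T : FellerSemigroup E) : T.generator.IsClosed := by
  refine IsSeqClosed.isClosed fun x p hx hlim => ?_
  obtain ⟨f, g⟩ := p
  have hf : Tendsto (fun k => (x k).1) atTop (𝓝 f) := (continuous_fst.tendsto _).comp hlim
  have hg : Tendsto (fun k => (x k).2) atTop (𝓝 g) := (continuous_snd.tendsto _).comp hlim
  have hxG : ∀ k, T.HasGenerator (x k).1 (x k).2 := fun k => mem_generator_graph_iff.1 (hx k)
  refine mem_generator_graph_iff.2 (Metric.tendsto_nhds.2 fun r hr => ?_)
  -- the continuity of `s ↦ T_s g` at `0` controls the difference quotients uniformly in `k`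
  obtain ⟨d, hd, hT⟩ := Metric.tendsto_nhds_nhds.1 (T.tendsto_zero g) (r / 2) (half_pos hr)
  have hball : ∀ᶠ t : ℝ≥0 in 𝓝[>] 0, dist t 0 < d :=
    nhdsWithin_le_nhds (Metric.ball_mem_nhds 0 hd)
  filter_upwards [hball, self_mem_nhdsWithin] with t ht ht0
  have ht' : (0 : ℝ) < t := NNReal.coe_pos.2 ht0
  have hs : ∀ s ≤ t, ‖T.op s g - g‖ ≤ r / 2 := fun s hst => by
    rw [← dist_eq_norm]
    refine (hT (lt_of_le_of_lt ?_ ht)).le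
    rw [NNReal.dist_eq, NNReal.dist_eq, NNReal.coe_zero, sub_zero, sub_zero,
      abs_of_nonneg (NNReal.coe_nonneg s), abs_of_nonneg (NNReal.coe_nonneg t)]
    exact hst
  have hk : ∀ k, ‖T.op t (x k).1 - (x k).1 - (t : ℝ) • (x k).2‖ ≤
      t * (r / 2 + 2 * ‖(x k).2 - g‖) := fun k => by
    refine (hxG k).norm_op_sub_le ht0 fun s hst => ?_
    have h1 : T.op s (x k).2 - (x k).2 =
        T.op s ((x k).2 - g) + (T.op s g - g) - ((x k).2 - g) := by
      rw [map_sub]; abel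
    have h2 := norm_sub_le (T.op s ((x k).2 - g) + (T.op s g - g)) ((x k).2 - g)
    have h3 := norm_add_le (T.op s ((x k).2 - g)) (T.op s g - g)
    have h4 := T.norm_op_le s ((x k).2 - g)
    have h5 := hs s hst
    rw [h1]
    linarith
  have hlim1 : Tendsto (fun k => ‖T.op t (x k).1 - (x k).1 - (t : ℝ) • (x k).2‖) atTop
      (𝓝 ‖T.op t f - f - (t : ℝ) • g‖) :=
    (((((T.op t).continuous.tendsto _).comp hf).sub hf).sub (hg.const_smul _)).norm
  have hlim2 : Tendsto (fun k => (t : ℝ) * (r / 2 + 2 * ‖(x k).2 - g‖)) atTop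
      (𝓝 (t * (r / 2))) := by
    have := (((hg.sub_const g).norm.const_mul 2).const_add (r / 2)).const_mul (t : ℝ)
    simpa using this
  have hle := le_of_tendsto_of_tendsto' hlim1 hlim2 hk
  have h3 : T.op t f - f - (t : ℝ) • g = (t : ℝ) • ((t : ℝ)⁻¹ • (T.op t f - f) - g) := by
    rw [smul_sub, smul_smul, mul_inv_cancel₀ ht'.ne', one_smul]
  rw [h3, norm_smul, Real.norm_of_nonneg ht'.le] at hle
  rw [dist_eq_norm]
  exact (le_of_mul_le_mul_left hle ht').trans_lt (half_lt_self hr)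

/-- A dense subspace `S` of the domain with `(1 - G) S = S` is a core: by dissipativity, the inverse
of `1 - G` is a contraction, so that `f = (1 - G)⁻¹ h` is approximated in the graph norm by
`(1 - G)⁻¹ h'` with `h'` in `S`. -/
theorem hasCore_of_dense (T : FellerSemigroup E) (S : Submodule ℝ C(E, ℝ))
    (hS : Dense (S : Set C(E, ℝ))) (hdom : S ≤ T.generator.domain)
    (hres : ∀ h ∈ S, ∃ f ∈ S, T.HasGenerator f (f - h)) : T.generator.HasCore S := by
  refine ⟨hdom, ?_⟩
  have hclos : (T.generator.domRestrict S).IsClosable :=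
    T.isClosed_generator.isClosable.leIsClosable LinearPMap.domRestrict_le
  refine LinearPMap.eq_of_eq_graph ?_
  rw [← hclos.graph_closure_eq_closure_graph]
  refine le_antisymm ?_ ?_
  · rw [← T.isClosed_generator.submodule_topologicalClosure_eq]
    exact Submodule.topologicalClosure_mono (LinearPMap.le_graph_of_le LinearPMap.domRestrict_le)
  · rintro ⟨f, g⟩ hfg
    have hG := mem_generator_graph_iff.1 hfg
    refine Metric.mem_closure_iff.2 fun r hr => ?_
    obtain ⟨h', hh', hh'S⟩ := Metric.dense_iff.1 hS (f - g) (r / 2) (half_pos hr)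
    obtain ⟨f', hf'S, hf'⟩ := hres h' hh'S
    rw [Metric.mem_ball, dist_eq_norm] at hh'
    refine ⟨(f', f' - h'), ?_, ?_⟩
    · refine LinearPMap.mem_graph_iff _ |>.2 ⟨⟨f', hf'S, hdom hf'S⟩, rfl, ?_⟩
      exact (LinearPMap.domRestrict_apply (y := ⟨f', hdom hf'S⟩) rfl).trans
        (hf'.generator_apply _)
    · have h1 := (hf'.sub hG).norm_le
      have h2 : f' - f - (f' - h' - g) = h' - (f - g) := by abel
      rw [h2] at h1
      have h3 : f' - h' - g = (f' - f) - (h' - (f - g)) := by abel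
      have h4 := norm_sub_le (f' - f) (h' - (f - g))
      rw [dist_comm, Prod.dist_eq, max_lt_iff, dist_eq_norm, dist_eq_norm]
      simp only
      rw [h3]
      exact ⟨by linarith, by linarith⟩

end FellerSemigroup

namespace NatPartition

instance finiteDimensional_D (n : ℕ) : FiniteDimensional ℝ (D n) := by
  have := (finite_range_trunc n).to_subtype
  let R : D n →ₗ[ℝ] (Set.range (trunc n) → ℝ) :=
    { toFun := fun f η => f.1 η.1
      map_add' := fun _ _ => rfl
      map_smul' := fun _ _ => rfl }
  refine Module.Finite.of_injective R fun f g hfg => Subtype.ext (ContinuousMap.ext fun η => ?_)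
  rw [← apply_trunc_of_mem_D f.2, ← apply_trunc_of_mem_D g.2]
  exact congr_fun hfg ⟨trunc n η, η, rfl⟩

end NatPartition

namespace IsTreeDestruction

open NatPartition

variable {Ω : Type*} [MeasurableSpace Ω] {μ : Measure Ω} [IsProbabilityMeasure μ]
  {u : (i : ℕ) → Ω → Fin (i + 1)} {e : ℕ → Ω → ℝ}

theorem Dinf_le_domain (h : IsTreeDestruction μ u e) : Dinf ≤ h.semigroup.generator.domain :=
  fun _ ⟨_, _, hf⟩ => ⟨_, h.hasGenerator hf⟩

theorem hasCore_Dinf (h : IsTreeDestruction μ u e) : h.semigroup.generator.HasCore Dinf := by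
  refine h.semigroup.hasCore_of_dense Dinf dense_Dinf h.Dinf_le_domain ?_
  rintro g ⟨n, hn, hg⟩
  -- on the finite dimensional space `D n`, the injective operator `1 - G` is surjective
  let L : D n →ₗ[ℝ] D n :=
    { toFun := fun f => ⟨f.1 - genFun n f.1, (D n).sub_mem f.2 (ofAgreeOn_mem _)⟩
      map_add' := fun f f' => Subtype.ext (ContinuousMap.ext fun η => by
        change f.1 η + f'.1 η - gen n η (⇑f.1 + ⇑f'.1) =
          (f.1 η - gen n η f.1) + (f'.1 η - gen n η f'.1)
        rw [map_add]
        ring)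
      map_smul' := fun c f => Subtype.ext (ContinuousMap.ext fun η => by
        change c * f.1 η - gen n η (c • ⇑f.1) = c * (f.1 η - gen n η f.1)
        rw [map_smul, smul_eq_mul]
        ring) }
  have hinj : Function.Injective L := (injective_iff_map_eq_zero L).2 fun f hf => by
    have h1 := (h.hasGenerator f.2).norm_le
    have h2 : f.1 - genFun n f.1 = 0 := congrArg Subtype.val hf
    rw [h2, norm_zero] at h1
    exact Subtype.ext (norm_le_zero_iff.1 h1)
  obtain ⟨f, hf⟩ := LinearMap.injective_iff_surjective.1 hinj ⟨g, hg⟩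
  refine ⟨f.1, ⟨n, hn, f.2⟩, ?_⟩
  have h1 : f.1 - genFun n f.1 = g := congrArg Subtype.val hf
  rw [← h1, sub_sub_cancel]
  exact h.hasGenerator f.2

end IsTreeDestruction

namespace NatPartition

/-! ### Blocks and fragmentation -/

theorem blockMin_rel (η : NatPartition) (x : ℕ) : η.rel (η.blockMin x) x :=
  Nat.sInf_mem (s := {y | η.rel y x}) ⟨x, η.iseqv.refl x⟩

theorem blockMin_le_of_rel {η : NatPartition} {x y : ℕ} (h : η.rel y x) : η.blockMin x ≤ y :=
  Nat.sInf_le (s := {y | η.rel y x}) h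

theorem isMin_blockMin (η : NatPartition) (x : ℕ) : η.IsMin (η.blockMin x) := fun _ hj hr =>
  absurd (blockMin_le_of_rel (η.iseqv.trans hr (η.blockMin_rel x))) (not_le.2 hj)

theorem blockMin_eq_iff {η : NatPartition} {x y : ℕ} : η.blockMin x = η.blockMin y ↔ η.rel x y := by
  constructor
  · intro h
    exact η.iseqv.trans (η.iseqv.symm (η.blockMin_rel x)) (h ▸ η.blockMin_rel y)
  · intro h
    exact le_antisymm
      (blockMin_le_of_rel (η.iseqv.trans (η.blockMin_rel y) (η.iseqv.symm h)))
      (blockMin_le_of_rel (η.iseqv.trans (η.blockMin_rel x) h))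

theorem finite_isMin_lt (η : NatPartition) (k : ℕ) : {m | η.IsMin m ∧ m < k}.Finite :=
  (Set.finite_lt_nat k).subset fun _ hm => hm.2

theorem blockIndex_lt_of_blockMin_lt {η : NatPartition} {x y : ℕ}
    (h : η.blockMin x < η.blockMin y) : η.blockIndex x < η.blockIndex y := by
  refine Set.ncard_lt_ncard ⟨fun m hm => ⟨hm.1, hm.2.trans h⟩, fun hsub => ?_⟩
    (η.finite_isMin_lt _)
  exact lt_irrefl _ (hsub ⟨η.isMin_blockMin x, h⟩).2

theorem blockIndex_eq_iff {η : NatPartition} {x y : ℕ} :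
    η.blockIndex x = η.blockIndex y ↔ η.rel x y := by
  rw [← blockMin_eq_iff]
  refine ⟨fun h => ?_, fun h => by rw [blockIndex, blockIndex, h]⟩
  rcases lt_trichotomy (η.blockMin x) (η.blockMin y) with h' | h' | h'
  · exact absurd h (blockIndex_lt_of_blockMin_lt h').ne
  · exact h'
  · exact absurd h (blockIndex_lt_of_blockMin_lt h').ne'

theorem blockIndex_le (η : NatPartition) (x : ℕ) : η.blockIndex x ≤ x := by
  have h1 : η.blockIndex x ≤ (Set.Iio x).ncard := Set.ncard_le_ncard
    (fun m hm => hm.2.trans_le (blockMin_le_of_rel (η.iseqv.refl x))) (Set.finite_Iio x)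
  rwa [← Finset.coe_Iio, Set.ncard_coe_finset, Nat.card_Iio] at h1

theorem mem_block_blockIndex {η : NatPartition} {x n : ℕ} :
    x ∈ η.block (η.blockIndex n) ↔ η.rel x n := blockIndex_eq_iff

theorem posIn_lt {B : Set ℕ} {x y : ℕ} (hx : x ∈ B) (hxy : x < y) : posIn B x < posIn B y := by
  refine Set.ncard_lt_ncard ⟨fun z hz => ⟨hz.1, hz.2.trans hxy⟩, fun hsub => ?_⟩
    ((Set.finite_lt_nat y).subset fun _ hz => hz.2)
  exact lt_irrefl _ (hsub ⟨hx, hxy⟩).2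

theorem posIn_le (B : Set ℕ) (x : ℕ) : posIn B x ≤ x := by
  have h1 : posIn B x ≤ (Set.Iio x).ncard :=
    Set.ncard_le_ncard (fun z hz => hz.2) (Set.finite_Iio x)
  rwa [← Finset.coe_Iio, Set.ncard_coe_finset, Nat.card_Iio] at h1

theorem posIn_block (η : NatPartition) (n : ℕ) :
    posIn (η.block (η.blockIndex n)) n = (η.earlier n).card := by
  rw [posIn, ← Set.ncard_coe_finset]
  congr 1
  ext y
  rw [Set.mem_ofPred_eq, mem_block_blockIndex, Finset.mem_coe, mem_earlier, and_comm]

/-- The elements below `n` in the block of `n` occupy the first positions of this block. -/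
theorem image_posIn_earlier (η : NatPartition) (n : ℕ) :
    (η.earlier n).image (posIn (η.block (η.blockIndex n))) = Finset.range (η.earlier n).card := by
  refine Finset.eq_of_subset_of_card_le (fun p hp => ?_) ?_
  · obtain ⟨j, hj, rfl⟩ := Finset.mem_image.1 hp
    obtain ⟨hjn, hr⟩ := mem_earlier.1 hj
    rw [Finset.mem_range, ← posIn_block]
    exact posIn_lt (mem_block_blockIndex.2 hr) hjn
  · rw [Finset.card_range, Finset.card_image_of_injOn]
    intro j hj k hk hjk
    rcases lt_trichotomy j k with h | h | h
    · exact absurd hjk (posIn_lt (mem_block_blockIndex.2 (mem_earlier.1 hj).2) h).ne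
    · exact h
    · exact absurd hjk (posIn_lt (mem_block_blockIndex.2 (mem_earlier.1 hk).2) h).ne'

theorem fragment_agreeOn_fragment {η π ρ : NatPartition} {i n : ℕ}
    (h : ∀ x ∈ η.block i, x < n → ∀ y ∈ η.block i, y < n →
      (π.rel (posIn (η.block i) x) (posIn (η.block i) y) ↔
        ρ.rel (posIn (η.block i) x) (posIn (η.block i) y))) :
    AgreeOn n (η.fragment i π) (η.fragment i ρ) := fun x hx y hy =>
  and_congr_right fun _ => forall_congr' fun hxB => forall_congr' fun hyB => h x hxB hx y hyB hy

theorem AgreeOn.fragment {η π ρ : NatPartition} {n : ℕ} (h : AgreeOn n π ρ) (i : ℕ) :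
    AgreeOn n (η.fragment i π) (η.fragment i ρ) :=
  fragment_agreeOn_fragment fun _ _ hx _ _ hy =>
    h _ ((posIn_le _ _).trans_lt hx) _ ((posIn_le _ _).trans_lt hy)

theorem fragment_agreeOn {η π : NatPartition} {i n : ℕ}
    (h : ∀ x ∈ η.block i, x < n → ∀ y ∈ η.block i, y < n →
      π.rel (posIn (η.block i) x) (posIn (η.block i) y)) :
    AgreeOn n (η.fragment i π) η := fun x hx y hy =>
  ⟨fun hr => hr.1, fun hr => ⟨hr, fun hxB hyB => h x hxB hx y hyB hy⟩⟩

theorem fragment_agreeOn_of_le {n i : ℕ} (hi : n ≤ i) (η π : NatPartition) :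
    AgreeOn n (η.fragment i π) η := fragment_agreeOn fun x hx hxn => by
  have h1 := η.blockIndex_le x
  have h2 : η.blockIndex x = i := hx
  omega

theorem earlier_fragment_of_ne {η : NatPartition} {n i : ℕ} (hi : i ≠ η.blockIndex n)
    (π : NatPartition) : (η.fragment i π).earlier n = η.earlier n := by
  ext j
  rw [mem_earlier, mem_earlier]
  exact and_congr_right fun _ => ⟨fun h => h.1, fun h => ⟨h, fun _ hn => absurd hn.symm hi⟩⟩

theorem mem_earlier_fragment {η π : NatPartition} {n j : ℕ} :
    j ∈ (η.fragment (η.blockIndex n) π).earlier n ↔ j ∈ η.earlier n ∧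
      π.rel (posIn (η.block (η.blockIndex n)) j) (η.earlier n).card := by
  rw [mem_earlier, mem_earlier, ← posIn_block, and_assoc]
  refine and_congr_right fun _ => ⟨fun h => ⟨h.1, ?_⟩, fun h => ⟨h.1, fun _ _ => h.2⟩⟩
  exact h.2 (mem_block_blockIndex.2 h.1) (mem_block_blockIndex.2 (η.iseqv.refl n))

/-- The sum over all blocks of the increments of `f` when this block of `η` is split by `π`. -/
noncomputable def splitSum (f : NatPartition → ℝ) (η π : NatPartition) : ℝ :=
  ∑' i : ℕ, (f (η.fragment i π) - f η)

section

variable {n : ℕ} {f : NatPartition → ℝ}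

theorem increment_eq_zero (hf : ∀ σ τ, AgreeOn n σ τ → f σ = f τ) (η π : NatPartition) {i : ℕ}
    (hi : i ∉ Finset.range n) : f (η.fragment i π) - f η = 0 :=
  sub_eq_zero.2 (hf _ _ (fragment_agreeOn_of_le (by simpa using hi) η π))

theorem summable_increment (hf : ∀ σ τ, AgreeOn n σ τ → f σ = f τ) (η π : NatPartition) :
    Summable fun i : ℕ => f (η.fragment i π) - f η :=
  summable_of_ne_finset_zero (s := Finset.range n) fun _ hi => increment_eq_zero hf η π hi

theorem splitSum_eq_sum (hf : ∀ σ τ, AgreeOn n σ τ → f σ = f τ) (η π : NatPartition) :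
    splitSum f η π = ∑ i ∈ Finset.range n, (f (η.fragment i π) - f η) :=
  tsum_eq_sum fun _ hi => increment_eq_zero hf η π hi

theorem splitSum_congr (hf : ∀ σ τ, AgreeOn n σ τ → f σ = f τ) (η : NatPartition)
    (π ρ : NatPartition) (h : AgreeOn n π ρ) : splitSum f η π = splitSum f η ρ :=
  tsum_congr fun i => by rw [hf _ _ (h.fragment i)]

end

/-- Passing from `n` to `n + 1` vertices only changes the increment for the block of `n`. -/
theorem splitSum_trunc_succ (η π : NatPartition) (n : ℕ) (g : NatPartition → ℝ) :
    splitSum (fun σ => g (trunc (n + 1) σ)) η π =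
      splitSum (fun σ => avg η n g (trunc n σ)) η π +
      (g (trunc (n + 1) (η.fragment (η.blockIndex n) π)) -
        avg η n g (trunc n (η.fragment (η.blockIndex n) π))) := by
  rw [splitSum_eq_sum (n := n + 1) fun σ τ h => by rw [h.trunc_eq],
    splitSum_eq_sum (n := n + 1) fun σ τ h => by rw [(h.mono n.le_succ).trunc_eq],
    ← sub_eq_iff_eq_add', ← Finset.sum_sub_distrib, Finset.sum_eq_single (η.blockIndex n)]
  · rw [avg_trunc]
    ring
  · intro i _ hi
    have h1 : avg η n = avg (η.fragment i π) n := by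
      simp only [avg, earlier_fragment_of_ne hi]
    rw [avg_trunc, h1, avg_trunc]
    ring
  · intro h
    exact absurd (Finset.mem_range.2 (Nat.lt_succ_of_le (η.blockIndex_le n))) h

/-! ### The Pólya urn -/

variable {m : ℕ} {v : (i : ℕ) → Fin (i + 1)}

theorem not_urnRed_of_lt {x : ℕ} (h : x < m) : ¬ UrnRed m v x := by
  intro hr
  cases hr with
  | initial => omega
  | copy i hi _ => omega

theorem urnRed_succ {i : ℕ} (h : m ≤ i) : UrnRed m v (i + 1) ↔ UrnRed m v (v i : ℕ) := by
  refine ⟨fun hr => ?_, fun hr => UrnRed.copy i h hr⟩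
  obtain ⟨x, hx⟩ : ∃ x, x = i + 1 := ⟨_, rfl⟩
  rw [← hx] at hr
  cases hr with
  | initial => omega
  | copy j hj hr =>
    obtain rfl : i = j := by omega
    exact hr

theorem urnRed_congr {v' : (i : ℕ) → Fin (i + 1)} {c : ℕ} (h : ∀ i < c, v i = v' i) {x : ℕ}
    (hx : x ≤ c) : UrnRed m v x ↔ UrnRed m v' x := by
  induction x using Nat.strong_induction_on with
  | _ x ih =>
    rcases lt_trichotomy x m with hlt | rfl | hlt
    · exact iff_of_false (not_urnRed_of_lt hlt) (not_urnRed_of_lt hlt)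
    · exact iff_of_true UrnRed.initial UrnRed.initial
    · obtain ⟨i, rfl⟩ : ∃ i, x = i + 1 := ⟨x - 1, by omega⟩
      have hlt' := (v i).2
      rw [urnRed_succ (by omega), urnRed_succ (by omega), ← h i (by omega)]
      exact ih _ (by omega) (by omega)

theorem measurableSet_urnRed (m x : ℕ) :
    MeasurableSet {v : (i : ℕ) → Fin (i + 1) | UrnRed m v x} := by
  induction x using Nat.strong_induction_on with
  | _ x ih =>
    rcases lt_trichotomy x m with hlt | rfl | hlt
    · simp only [not_urnRed_of_lt hlt, Set.ofPred_false, MeasurableSet.empty]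
    · simp only [UrnRed.initial, Set.ofPred_true, MeasurableSet.univ]
    · obtain ⟨i, rfl⟩ : ∃ i, x = i + 1 := ⟨x - 1, by omega⟩
      have hset : {v : (i : ℕ) → Fin (i + 1) | UrnRed m v (i + 1)} =
          ⋃ w : Fin (i + 1), (fun v : (i : ℕ) → Fin (i + 1) => v i) ⁻¹' {w} ∩
            {v | UrnRed m v (w : ℕ)} := by
        ext v
        simp only [Set.mem_ofPred_eq, Set.mem_iUnion, Set.mem_inter_iff, Set.mem_preimage,
          Set.mem_singleton_iff, urnRed_succ (show m ≤ i by omega)]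
        exact ⟨fun h => ⟨v i, rfl, h⟩, fun ⟨w, hw, h⟩ => hw ▸ h⟩
      rw [hset]
      refine MeasurableSet.iUnion fun w => ?_
      have hw := w.2
      exact ((measurable_pi_apply i) (measurableSet_singleton w)).inter (ih _ (by omega))

theorem measurable_urnPartition (m : ℕ) : Measurable (urnPartition m) := by
  refine measurable_of_rel fun i j => ?_
  have hset : {v | (urnPartition m v).rel i j} =
      ({v | UrnRed m v i} ∩ {v | UrnRed m v j}) ∪ ({v | UrnRed m v i}ᶜ ∩ {v | UrnRed m v j}ᶜ) := by
    ext v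
    simp only [Set.mem_union, Set.mem_inter_iff, Set.mem_compl_iff, Set.mem_ofPred_eq]
    exact iff_iff_and_or_not_and_not
  rw [hset]
  have hi := measurableSet_urnRed m i
  have hj := measurableSet_urnRed m j
  exact (hi.inter hj).union (hi.compl.inter hj.compl)

instance (m : ℕ) : IsProbabilityMeasure (polyaLaw m) :=
  Measure.isProbabilityMeasure_map (measurable_urnPartition m).aemeasurable

theorem integral_polyaLaw (m : ℕ) {F : NatPartition → ℝ} (hF : Measurable F) :
    ∫ π, F π ∂(polyaLaw m) = ∫ v, F (urnPartition m v) ∂(Measure.infinitePi uniformLaw) :=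
  integral_map (measurable_urnPartition m).aemeasurable hF.aestronglyMeasurable

/-- The pick number `c` is uniform and independent of the previous ones. -/
theorem integral_infinitePi_pick {c : ℕ} {F : ((i : ℕ) → Fin (i + 1)) → Fin (c + 1) → ℝ}
    (hF : ∀ v v', (∀ i < c, v i = v' i) → F v = F v') :
    ∫ v, F v (v c) ∂(Measure.infinitePi uniformLaw) =
      ∫ v, ((c + 1 : ℕ) : ℝ)⁻¹ * ∑ w, F v w ∂(Measure.infinitePi uniformLaw) := by
  let P := Measure.infinitePi uniformLaw
  let R : ((i : ℕ) → Fin (i + 1)) → ((i : Finset.range c) → Fin ((i : ℕ) + 1)) := fun v i => v i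
  let ext : ((i : Finset.range c) → Fin ((i : ℕ) + 1)) → ((i : ℕ) → Fin (i + 1)) := fun x i =>
    if hi : i ∈ Finset.range c then x ⟨i, hi⟩ else 0
  have hR : Measurable R := measurable_pi_lambda _ fun i => measurable_pi_apply _
  have hext : ∀ v, F (ext (R v)) = F v := fun v => hF _ _ fun i hi => by simp [ext, R, hi]
  have hind : IndepFun R (fun v => v c) P := by
    have h1 : iIndepFun (fun (i : ℕ) (v : (i : ℕ) → Fin (i + 1)) => v i) P :=
      iIndepFun_infinitePi (X := fun _ x => x) fun _ => measurable_id
    exact (h1.indepFun_finset (Finset.range c) {c} (by simp) fun i => measurable_pi_apply i).comp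
      measurable_id
      (measurable_pi_apply (⟨c, Finset.mem_singleton_self c⟩ : ({c} : Finset ℕ)))
  have hlaw : P.map (fun v => (R v, v c)) = (P.map R).prod (uniformLaw c) := by
    rw [(indepFun_iff_map_prod_eq_prod_map_map hR.aemeasurable
      (measurable_pi_apply c).aemeasurable).1 hind]
    congr 1
    exact Measure.infinitePi_map_eval _ c
  have := Measure.isProbabilityMeasure_map (μ := P) hR.aemeasurable
  have hm : Measurable fun q : ((i : Finset.range c) → Fin ((i : ℕ) + 1)) × Fin (c + 1) =>
    F (ext q.1) q.2 := Measurable.of_discrete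
  have h1 : ∫ v, F v (v c) ∂P = ∫ q, F (ext q.1) q.2 ∂(P.map fun v => (R v, v c)) := by
    rw [integral_map (hR.prodMk (measurable_pi_apply c)).aemeasurable hm.aestronglyMeasurable]
    simp only [hext]
  refine h1.trans ?_
  rw [hlaw, integral_prod _ .of_finite]
  simp only [integral_uniformLaw]
  rw [integral_map hR.aemeasurable (Measurable.of_discrete).aestronglyMeasurable]
  simp only [hext]
  rfl

end NatPartition

namespace NatPartition

/-! ### The generator as an integral against the splitting rates -/

theorem integrable_of_agreeOn {n : ℕ} {f : NatPartition → ℝ}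
    (hf : ∀ σ τ, AgreeOn n σ τ → f σ = f τ) (ν : Measure NatPartition) [IsFiniteMeasure ν] :
    Integrable f ν :=
  Integrable.of_bound (measurable_of_agreeOn hf).aestronglyMeasurable ‖ofAgreeOn n f hf‖
    (ae_of_all _ fun σ => (ofAgreeOn n f hf).norm_coe_le_norm σ)

theorem urnPartition_rel_of_lt {m x y : ℕ} (hx : x < m) (hy : y < m) (v : (i : ℕ) → Fin (i + 1)) :
    (urnPartition m v).rel x y :=
  iff_of_false (not_urnRed_of_lt hx) (not_urnRed_of_lt hy)

theorem posIn_lt_card_earlier {η : NatPartition} {n x : ℕ} (hx : x ∈ η.block (η.blockIndex n))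
    (hxn : x < n) : posIn (η.block (η.blockIndex n)) x < (η.earlier n).card := by
  rw [← posIn_block]
  exact posIn_lt hx hxn

theorem exists_earlier_of_lt_card (η : NatPartition) {n p : ℕ} (hp : p < (η.earlier n).card) :
    ∃ j ∈ η.earlier n, posIn (η.block (η.blockIndex n)) j = p := by
  have := Finset.mem_range.2 hp
  rwa [← image_posIn_earlier, Finset.mem_image] at this

theorem posIn_injOn_earlier (η : NatPartition) (n : ℕ) :
    Set.InjOn (posIn (η.block (η.blockIndex n))) (η.earlier n) := by
  refine Finset.card_image_iff.1 ?_
  rw [image_posIn_earlier, Finset.card_range]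

/-- The increment caused by the vertex `n` when its block is split by the urn with `m` initial black
balls; `n` is the ball number `b = (η.earlier n).card`. For `m < b`, this ball copies the colour
of a uniform earlier ball, which amounts to attaching `n` to a uniform earlier element of its block.
For `m = b`, it is the first red ball, and `n` is separated from the earlier elements. For `m > b`,
it is black like the earlier balls. -/
theorem integral_last_increment (η : NatPartition) (n : ℕ) (g : NatPartition → ℝ) {m : ℕ}
    (hm : 1 ≤ m) :
    ∫ π, (g (trunc (n + 1) (η.fragment (η.blockIndex n) π)) -
        avg η n g (trunc n (η.fragment (η.blockIndex n) π))) ∂(polyaLaw m) =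
      if m = (η.earlier n).card then g (trunc n η) - g (trunc (n + 1) η) else 0 := by
  have hd1 : ∀ π ρ, AgreeOn (n + 1) π ρ → g (trunc (n + 1) (η.fragment (η.blockIndex n) π)) =
      g (trunc (n + 1) (η.fragment (η.blockIndex n) ρ)) := fun π ρ h => by
    rw [(h.fragment _).trunc_eq]
  have hd2 : ∀ π ρ, AgreeOn n π ρ → avg η n g (trunc n (η.fragment (η.blockIndex n) π)) =
      avg η n g (trunc n (η.fragment (η.blockIndex n) ρ)) := fun π ρ h => by
    rw [(h.fragment _).trunc_eq]
  have hm1 := measurable_of_agreeOn hd1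
  have hm2 := measurable_of_agreeOn hd2
  have hm3 : Measurable fun π => g (trunc (n + 1) (η.fragment (η.blockIndex n) π)) -
      avg η n g (trunc n (η.fragment (η.blockIndex n) π)) := hm1.sub hm2
  rcases lt_trichotomy m (η.earlier n).card with hlt | heq | hgt
  · rw [if_neg hlt.ne, integral_sub (integrable_of_agreeOn hd1 _) (integrable_of_agreeOn hd2 _),
      sub_eq_zero, integral_polyaLaw m hm1, integral_polyaLaw m hm2]
    obtain ⟨c, hc⟩ : ∃ c, (η.earlier n).card = c + 1 := ⟨(η.earlier n).card - 1, by omega⟩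
    have hex : ∀ p, ∃ j, p < (η.earlier n).card →
        j ∈ η.earlier n ∧ posIn (η.block (η.blockIndex n)) j = p := fun p => by
      by_cases hp : p < (η.earlier n).card
      · obtain ⟨j, hj⟩ := η.exists_earlier_of_lt_card hp
        exact ⟨j, fun _ => hj⟩
      · exact ⟨0, fun h => absurd h hp⟩
    -- `J p` is the element in position `p` of the block
    choose J hJ using hex
    let F : ((i : ℕ) → Fin (i + 1)) → Fin (c + 1) → ℝ := fun v w =>
      g (attach (trunc n (η.fragment (η.blockIndex n) (urnPartition m v))) n (J w))
    have hF : ∀ v v', (∀ i < c, v i = v' i) → F v = F v' := by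
      intro v v' hvv
      have hag : AgreeOn n (η.fragment (η.blockIndex n) (urnPartition m v))
          (η.fragment (η.blockIndex n) (urnPartition m v')) := by
        refine fragment_agreeOn_fragment fun x hx hxn y hy hyn => ?_
        have hx' := posIn_lt_card_earlier hx hxn
        have hy' := posIn_lt_card_earlier hy hyn
        exact iff_congr (urnRed_congr hvv (by omega)) (urnRed_congr hvv (by omega))
      funext w
      simp only [F, hag.trunc_eq]
    have h1 : ∀ v : (i : ℕ) → Fin (i + 1),
        g (trunc (n + 1) (η.fragment (η.blockIndex n) (urnPartition m v))) = F v (v c) := by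
      intro v
      have hvc := (v c).2
      obtain ⟨hj, hpos⟩ := hJ (v c) (by omega)
      have hmem : J (v c) ∈ (η.fragment (η.blockIndex n) (urnPartition m v)).earlier n := by
        refine mem_earlier_fragment.2 ⟨hj, ?_⟩
        rw [hpos, hc]
        exact (urnRed_succ (by omega)).symm
      simp only [F, attach_trunc hmem]
    have h2 : ∀ v : (i : ℕ) → Fin (i + 1),
        avg η n g (trunc n (η.fragment (η.blockIndex n) (urnPartition m v))) =
          ((c + 1 : ℕ) : ℝ)⁻¹ * ∑ w, F v w := by
      intro v
      rw [avg_apply_of_nonempty (Finset.card_pos.1 (by omega)), hc]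
      congr 1
      simp only [F]
      rw [Fin.sum_univ_eq_sum_range (fun w => g (attach (trunc n
        (η.fragment (η.blockIndex n) (urnPartition m v))) n (J w)))]
      refine Finset.sum_nbij' (posIn (η.block (η.blockIndex n))) J (fun j hj => ?_)
        (fun p hp => ?_) (fun j hj => ?_) (fun p hp => ?_) (fun j hj => ?_)
      · rw [← hc, ← image_posIn_earlier]
        exact Finset.mem_image_of_mem _ hj
      · exact (hJ p (by rw [hc]; exact Finset.mem_range.1 hp)).1
      · have hp : posIn (η.block (η.blockIndex n)) j < (η.earlier n).card := by
          rw [← Finset.mem_range, ← image_posIn_earlier]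
          exact Finset.mem_image_of_mem _ hj
        exact η.posIn_injOn_earlier n (hJ _ hp).1 hj (hJ _ hp).2
      · exact (hJ p (by rw [hc]; exact Finset.mem_range.1 hp)).2
      · have hp : posIn (η.block (η.blockIndex n)) j < (η.earlier n).card := by
          rw [← Finset.mem_range, ← image_posIn_earlier]
          exact Finset.mem_image_of_mem _ hj
        rw [η.posIn_injOn_earlier n (hJ _ hp).1 hj (hJ _ hp).2]
    simp only [h1, h2]
    exact integral_infinitePi_pick hF
  · rw [if_pos heq, integral_polyaLaw m hm3]
    have h1 : ∀ v : (i : ℕ) → Fin (i + 1),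
        (η.fragment (η.blockIndex n) (urnPartition m v)).earlier n = ∅ := by
      intro v
      ext j
      rw [mem_earlier_fragment, ← heq]
      simp only [Finset.notMem_empty, iff_false, not_and]
      intro hj hr
      have hj' := posIn_lt_card_earlier (mem_block_blockIndex.2 (mem_earlier.1 hj).2)
        (mem_earlier.1 hj).1
      exact not_urnRed_of_lt (heq ▸ hj') (hr.2 UrnRed.initial)
    have h2 : ∀ v : (i : ℕ) → Fin (i + 1),
        trunc n (η.fragment (η.blockIndex n) (urnPartition m v)) = trunc n η := fun v =>
      (fragment_agreeOn fun x hx hxn y hy hyn => urnPartition_rel_of_lt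
        (heq ▸ posIn_lt_card_earlier hx hxn) (heq ▸ posIn_lt_card_earlier hy hyn) v).trunc_eq
    simp only [trunc_succ_of_earlier_eq_empty (h1 _), h2, avg_trunc]
    simp
  · rw [if_neg hgt.ne', integral_polyaLaw m hm3]
    have hpos : ∀ x ∈ η.block (η.blockIndex n), x < n + 1 →
        posIn (η.block (η.blockIndex n)) x < m := by
      intro x hx hxn
      rcases Nat.lt_succ_iff_lt_or_eq.1 hxn with h | rfl
      · exact (posIn_lt_card_earlier hx h).trans hgt
      · rwa [posIn_block]
    have h1 : ∀ v : (i : ℕ) → Fin (i + 1),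
        AgreeOn (n + 1) (η.fragment (η.blockIndex n) (urnPartition m v)) η := fun v =>
      fragment_agreeOn fun x hx hxn y hy hyn =>
        urnPartition_rel_of_lt (hpos x hx hxn) (hpos y hy hyn) v
    have h2 : ∀ v, trunc n (η.fragment (η.blockIndex n) (urnPartition m v)) = trunc n η :=
      fun v => ((h1 v).mono n.le_succ).trunc_eq
    simp only [(h1 _).trunc_eq, h2, avg_trunc]
    simp

theorem integral_splitSum_trunc_succ (η : NatPartition) (n : ℕ) (g : NatPartition → ℝ) {m : ℕ}
    (hm : 1 ≤ m) :
    ∫ π, splitSum (fun σ => g (trunc (n + 1) σ)) η π ∂(polyaLaw m) =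
      ∫ π, splitSum (fun σ => avg η n g (trunc n σ)) η π ∂(polyaLaw m) +
        if m = (η.earlier n).card then g (trunc n η) - g (trunc (n + 1) η) else 0 := by
  simp only [splitSum_trunc_succ]
  rw [integral_add, integral_last_increment η n g hm]
  · exact integrable_of_agreeOn (n := n)
      (splitSum_congr (fun σ τ h => by rw [h.trunc_eq]) η) _
  · refine integrable_of_agreeOn (n := n + 1) (fun σ τ h => ?_) _
    rw [(h.fragment _).trunc_eq, ((h.mono n.le_succ).fragment _).trunc_eq]

/-- Only the urns with less than `n` initial black balls contribute to functions of the first `n`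
integers. -/
theorem splitSum_urnPartition_of_le {n m : ℕ} (hnm : n ≤ m) {f : NatPartition → ℝ}
    (hf : ∀ σ τ, AgreeOn n σ τ → f σ = f τ) (η : NatPartition) (v : (i : ℕ) → Fin (i + 1)) :
    splitSum f η (urnPartition m v) = 0 := by
  have h : ∀ i, f (η.fragment i (urnPartition m v)) - f η = 0 := fun i => by
    refine sub_eq_zero.2 (hf _ _ (fragment_agreeOn fun x _ hxn y _ hyn =>
      urnPartition_rel_of_lt ?_ ?_ v))
    · exact ((posIn_le _ x).trans_lt hxn).trans_le hnm
    · exact ((posIn_le _ y).trans_lt hyn).trans_le hnm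
  simp [splitSum, h]

theorem sum_integral_splitSum (η : NatPartition) {n N : ℕ} (hN : n ≤ N) (g : NatPartition → ℝ) :
    ∑ m ∈ Finset.range N, ∫ π, splitSum (fun σ => g (trunc n σ)) η π ∂(polyaLaw (m + 1)) =
      gen n η g := by
  induction n generalizing g with
  | zero =>
    refine Finset.sum_eq_zero fun m _ => ?_
    simp [splitSum, trunc_zero]
  | succ n ih =>
    simp only [integral_splitSum_trunc_succ η n g (Nat.le_add_left 1 _), Finset.sum_add_distrib]
    rw [ih (by omega), gen_succ_apply, add_sub_assoc]
    congr 1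
    rcases (η.earlier n).eq_empty_or_nonempty with h | h
    · rw [trunc_succ_of_earlier_eq_empty h, sub_self]
      simp
    · obtain ⟨c, hc⟩ : ∃ c, (η.earlier n).card = c + 1 :=
        ⟨(η.earlier n).card - 1, by have := h.card_pos; omega⟩
      have hcn : c + 1 ≤ n := by
        have hsub : η.earlier n ⊆ Finset.range n := fun j hj =>
          Finset.mem_range.2 (mem_earlier.1 hj).1
        rw [← hc]
        exact (Finset.card_le_card hsub).trans (Finset.card_range n).le
      simp only [hc, Nat.add_right_cancel_iff]
      rw [Finset.sum_ite_eq', if_pos (Finset.mem_range.2 (by omega))]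

theorem integral_splitSum_of_le {n m : ℕ} (hnm : n ≤ m) {f : NatPartition → ℝ}
    (hf : ∀ σ τ, AgreeOn n σ τ → f σ = f τ) (η : NatPartition) :
    ∫ π, |splitSum f η π| ∂(polyaLaw m) = 0 := by
  rw [integral_polyaLaw m (F := fun π => |splitSum f η π|)
    (measurable_of_agreeOn (splitSum_congr hf η)).abs]
  simp [splitSum_urnPartition_of_le hnm hf]

theorem integrable_splitSum {n : ℕ} {f : NatPartition → ℝ}
    (hf : ∀ σ τ, AgreeOn n σ τ → f σ = f τ) (η : NatPartition) :
    Integrable (splitSum f η) splittingRate := by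
  have hd := splitSum_congr hf η
  refine ⟨(measurable_of_agreeOn hd).aestronglyMeasurable, ?_⟩
  rw [hasFiniteIntegral_iff_norm, splittingRate, lintegral_sum_measure,
    tsum_eq_sum (s := Finset.range n)]
  · exact ENNReal.sum_lt_top.2 fun m _ =>
      (hasFiniteIntegral_iff_norm _).1 (integrable_of_agreeOn hd (polyaLaw (m + 1))).2
  · intro m hm
    have hnm : n ≤ m + 1 := by rw [Finset.mem_range] at hm; omega
    rw [← ofReal_integral_eq_lintegral_ofReal (integrable_of_agreeOn hd _).norm
      (ae_of_all _ fun _ => norm_nonneg _)]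
    simp only [Real.norm_eq_abs, integral_splitSum_of_le hnm hf, ENNReal.ofReal_zero]

theorem integral_splitSum {n : ℕ} {f : NatPartition → ℝ}
    (hf : ∀ σ τ, AgreeOn n σ τ → f σ = f τ) (η : NatPartition) :
    ∫ π, splitSum f η π ∂splittingRate = gen n η f := by
  have h1 := hasSum_integral_measure (μ := fun m => polyaLaw (m + 1)) (integrable_splitSum hf η)
  have h2 : ∀ m ∉ Finset.range n, ∫ π, splitSum f η π ∂(polyaLaw (m + 1)) = 0 := fun m hm => by
    rw [Finset.mem_range] at hm
    rw [integral_polyaLaw _ (measurable_of_agreeOn (splitSum_congr hf η))]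
    simp [splitSum_urnPartition_of_le (show n ≤ m + 1 by omega) hf]
  have h3 : (fun σ => f (trunc n σ)) = f := funext fun σ => hf _ _ (trunc_agreeOn n σ)
  have h4 := sum_integral_splitSum η le_rfl (n := n) f
  rw [h3] at h4
  rw [← h4]
  exact h1.unique (hasSum_sum_of_ne_finset_zero h2)

end NatPartition

theorem theorem1 {Ω : Type*} [MeasurableSpace Ω] (μ : Measure Ω) [IsProbabilityMeasure μ]
    (u : (i : ℕ) → Ω → Fin (i + 1)) (e : ℕ → Ω → ℝ) (h : IsTreeDestruction μ u e) :
    ∃ T : FellerSemigroup NatPartition,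
      -- (i) the Feller semigroup of the process exists, and it is unique
      (IsMarkovWith μ (destruction u e) T ∧
        ∀ T' : FellerSemigroup NatPartition, IsMarkovWith μ (destruction u e) T' → T' = T) ∧
      -- (ii) invariant spaces and core
      (∀ n : ℕ, 1 ≤ n → ∀ (t : ℝ≥0), ∀ f ∈ NatPartition.D n, T.op t f ∈ NatPartition.D n) ∧
      T.generator.HasCore NatPartition.Dinf ∧
      -- (iii) the generator on the core, together with the convergence of the sum and the integral
      ∀ f ∈ NatPartition.Dinf, ∃ hf : f ∈ T.generator.domain, ∀ η : NatPartition,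
        (∀ π : NatPartition, Summable fun i : ℕ => f (η.fragment i π) - f η) ∧
        Integrable (fun π : NatPartition => ∑' i : ℕ, (f (η.fragment i π) - f η))
          NatPartition.splittingRate ∧
        T.generator ⟨f, hf⟩ η =
          ∫ π : NatPartition, (∑' i : ℕ, (f (η.fragment i π) - f η))
            ∂NatPartition.splittingRate := by
  refine ⟨h.semigroup, ⟨h.isMarkovWith, fun T' hT' => h.eq_semigroup T' hT'⟩,
    fun n _ t f hf => NatPartition.transOp_mem_D t hf, h.hasCore_Dinf, ?_⟩
  rintro f ⟨n, hn, hf⟩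
  refine ⟨h.Dinf_le_domain ⟨n, hn, hf⟩, fun η => ⟨NatPartition.summable_increment hf η,
    NatPartition.integrable_splitSum hf η, ?_⟩⟩
  rw [(h.hasGenerator hf).generator_apply]
  exact (NatPartition.integral_splitSum hf η).symm
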